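/- Fix a positive integer $d$. For an integer polynomial $h(t)=h_0+h_1t+\cdots+h_dt^d$ of degree at most $d$, write $$\frac{h(t)}{(1-t)^{d+1}}=\sum_{m\ge 0} g(m)\,t^m ,$$ and for every positive integer $n$ let $U_nh(t)=h_0(n)+h_1(n)t+\cdots+h_d(n)t^d$ be the integer polynomial of degree at most $d$ determined by $$\frac{U_nh(t)}{(1-t)^{d+1}}=\sum_{m\ge 0} g(nm)\,t^m .$$ Let $A_d(t)=\sum_{i=1}^d A(d,i)\,t^i$ be the Eulerian polynomial, where $A(d,i)$ is the number of permutations of $d$ elements with exactly $i-1$ descents. Then $A_d(t)$ has $d$ simple real roots $\rho_1<\rho_2<\cdots<\rho_d=0$, and there exist positive integers $m_d$ and $n_d$, depending only on $d$, such that the following holds for every polynomial $h(t)$ of degree at most $d$ with nonnegative integer coefficients and $h_0=1$. (1) For every $n\ge n_d$, the polynomial $U_nh(t)$ has $d$ simple, negative real roots $\beta_1(n)<\beta_2(n)<\cdots<\beta_d(n)<0$, and $\beta_i(n)\to\rho_i$ as $n\to\infty$ for each $1\le i\le d$. (2) For every $n\ge n_d$, the coefficients of $U_nh(t)$ are positive,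 strictly log-concave (that is, $h_i(n)^2>h_{i-1}(n)\,h_{i+1}(n)$ for $1\le i\le d-1$), and satisfy $h_i(n)<m_d\,h_d(n)$ for $0\le i\le d$. (3) If, in addition, $h_0+\cdots+h_{i+1}\ge h_d+\cdots+h_{d-i}$ for all $0\le i\le\lfloor d/2\rfloor-1$, then for every $n\ge n_d$ $$1=h_0=h_0(n)<h_d(n)<h_1(n)<\cdots<h_i(n)<h_{d-i}(n)<h_{i+1}(n)<\cdots<h_{\lfloor (d+1)/2\rfloor}(n)<m_d\,h_d(n);$$ that is, $h_i(n)<h_{d-i}(n)$ for $0\le i\le\lfloor (d-1)/2\rfloor$, $h_{d-i}(n)<h_{i+1}(n)$ for $0\le i\le\lfloor d/2\rfloor-1$, and $h_{\lfloor (d+1)/2\rfloor}(n)<m_d\,h_d(n)$. -/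

import Mathlib

open Polynomial

noncomputable section

/-- The coefficient `g(m)` of `t ^ m` in the power series expansion of
`h(t) / (1 - t) ^ (d + 1)`. -/
def expansionCoeff (d : ℕ) (h : ℤ[X]) (m : ℕ) : ℤ :=
  PowerSeries.coeff m ((h : PowerSeries ℤ) * (PowerSeries.invOneSubPow ℤ (d + 1)).val)

/-- The polynomial `U_n h` of degree at most `d`: the terms of degree at most `d` of the power
series `(1 - t) ^ (d + 1) * ∑ m, g(n m) t ^ m`. When `h` has degree at most `d` there are no other
terms, see `heckeU_spec`. -/
def heckeU (d n : ℕ) (h : ℤ[X]) : ℤ[X] :=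
  PowerSeries.trunc (d + 1)
    ((1 - PowerSeries.X) ^ (d + 1) * PowerSeries.mk fun m => expansionCoeff d h (n * m))

/-- The number of descents of a permutation `w` of `d` elements, that is, of positions `j` that are
not the last one and satisfy `w (j + 1) < w j`. -/
def descentCount {d : ℕ} (w : Equiv.Perm (Fin d)) : ℕ :=
  (Finset.univ.filter fun j : Fin d => ∃ hj : j.val + 1 < d, w ⟨j.val + 1, hj⟩ < w j).card

/-- The Eulerian number `A(d, i)`: the number of permutations of `d` elements with exactly
`i - 1` descents (and `A(d, 0) = 0`). -/
def eulerianNumber (d i : ℕ) : ℕ :=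
  (Finset.univ.filter fun w : Equiv.Perm (Fin d) => descentCount w + 1 = i).card

/-- The Eulerian polynomial `A_d(t) = ∑_{i = 1}^d A(d, i) t ^ i`. -/
def eulerianPoly (d : ℕ) : ℤ[X] :=
  ∑ i ∈ Finset.Icc 1 d, C (eulerianNumber d i : ℤ) * X ^ i

theorem coeff_one_sub_pow_mul_mk_eq_zero (e : ℕ) (f : ℕ → ℤ) (hf : (fwdDiff 1)^[e] f = 0)
    (k : ℕ) (hk : e ≤ k) :
    PowerSeries.coeff k ((1 - PowerSeries.X) ^ e * PowerSeries.mk f) = 0 := by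
  induction e generalizing f k with
  | zero =>
    have h0 : f = 0 := hf
    simp [h0]
  | succ e ih =>
    have key : (1 - PowerSeries.X) * PowerSeries.mk f =
        PowerSeries.C (f 0) + PowerSeries.X * PowerSeries.mk (fwdDiff 1 f) := by
      ext j
      rcases j with _ | j
      · simp [sub_mul]
      · simp only [sub_mul, one_mul, map_sub, map_add, PowerSeries.coeff_succ_X_mul,
          PowerSeries.coeff_mk, PowerSeries.coeff_C, fwdDiff]
        simp
    obtain ⟨k, rfl⟩ : ∃ l, k = l + 1 := ⟨k - 1, by omega⟩
    have hp : ((1 - PowerSeries.X : PowerSeries ℤ)) ^ e = (((1 - X : ℤ[X]) ^ e : ℤ[X]) :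
        PowerSeries ℤ) := by simp
    have hdeg : ((1 - X : ℤ[X]) ^ e).natDegree < k + 1 := by
      have h1 : (1 - X : ℤ[X]).natDegree ≤ 1 := by
        have := natDegree_sub_le (1 : ℤ[X]) X
        simpa using this
      have h2 := natDegree_pow_le_of_le e h1
      omega
    rw [pow_succ, mul_assoc, key, mul_add, map_add, mul_left_comm, PowerSeries.coeff_succ_X_mul,
      ih (fwdDiff 1 f) (by simpa [Function.iterate_succ_apply] using hf) k (by omega),
      PowerSeries.coeff_mul_C, hp, Polynomial.coeff_coe, coeff_eq_zero_of_natDegree_lt hdeg]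
    simp

theorem expansionCoeff_eq_sum (d : ℕ) (h : ℤ[X]) (hd : h.natDegree ≤ d) (m : ℕ) :
    expansionCoeff d h m =
      ∑ i ∈ Finset.range (d + 1), h.coeff i * ((m + d - i).choose d : ℤ) := by
  have hs : (h : PowerSeries ℤ) =
      ∑ i ∈ Finset.range (d + 1), PowerSeries.C (h.coeff i) * PowerSeries.X ^ i := by
    conv_lhs => rw [h.as_sum_range_C_mul_X_pow' (n := d + 1) (by omega)]
    simp only [← Polynomial.coeToPowerSeries.ringHom_apply, map_sum, map_mul, map_pow]
    simp [Polynomial.coeToPowerSeries.ringHom_apply]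
  rw [expansionCoeff, hs, Finset.sum_mul, map_sum]
  refine Finset.sum_congr rfl fun i hi => ?_
  rw [Finset.mem_range] at hi
  rw [mul_assoc, PowerSeries.coeff_C_mul, PowerSeries.coeff_X_pow_mul',
    PowerSeries.invOneSubPow_val_succ_eq_mk_add_choose]
  split_ifs with him
  · simp only [PowerSeries.coeff_mk]
    congr 3
    omega
  · rw [Nat.choose_eq_zero_of_lt (by omega)]
    simp

/-- If `h` has degree at most `d`, then `U_n h(t) / (1 - t) ^ (d + 1) = ∑ m, g(n m) t ^ m`. -/
theorem heckeU_spec (d n : ℕ) (h : ℤ[X]) (hd : h.natDegree ≤ d) :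
    (heckeU d n h : PowerSeries ℤ) * (PowerSeries.invOneSubPow ℤ (d + 1)).val =
      PowerSeries.mk fun m => expansionCoeff d h (n * m) := by
  have hdiff : (fwdDiff 1)^[d + 1] (fun m => expansionCoeff d h (n * m)) = 0 := by
    let P : ℚ[X] := ∑ i ∈ Finset.range (d + 1), C ((h.coeff i : ℚ) / d.factorial) *
      (descPochhammer ℚ d).comp (C (n : ℚ) * X + C ((d - i : ℕ) : ℚ))
    have hP : P.natDegree < d + 1 := by
      refine Nat.lt_succ_of_le (natDegree_sum_le_of_forall_le _ _ fun i _ => ?_)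
      refine (natDegree_C_mul_le _ _).trans (natDegree_comp_le.trans ?_)
      rw [descPochhammer_natDegree]
      calc d * _ ≤ d * 1 := Nat.mul_le_mul_left _ natDegree_linear_le
        _ = d := mul_one d
    have hev : ∀ m : ℕ, P.eval (m : ℚ) = (expansionCoeff d h (n * m) : ℚ) := by
      intro m
      rw [expansionCoeff_eq_sum d h hd]
      simp only [P, eval_finsetSum, Int.cast_sum]
      refine Finset.sum_congr rfl fun i hi => ?_
      rw [Finset.mem_range] at hi
      have e1 : ((n : ℚ) * m + ((d - i : ℕ) : ℚ)) = ((n * m + d - i : ℕ) : ℚ) := by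
        rw [Nat.add_sub_assoc (by omega)]
        push_cast
        ring
      have e2 : ((d.factorial : ℕ) : ℚ) ≠ 0 := by positivity
      simp only [eval_mul, eval_C, eval_comp, eval_add, eval_X, e1,
        descPochhammer_eval_eq_descFactorial, Nat.descFactorial_eq_factorial_mul_choose]
      push_cast
      field_simp
    have hz := Polynomial.fwdDiff_iter_eq_zero_of_degree_lt hP
    funext y
    have hy := congrFun hz (y : ℚ)
    rw [fwdDiff_iter_eq_sum_shift] at hy ⊢
    have hq : ((∑ k ∈ Finset.range (d + 1 + 1), ((-1 : ℤ) ^ (d + 1 - k) * (d + 1).choose k) •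
        expansionCoeff d h (n * (y + k • 1)) : ℤ) : ℚ) = 0 := by
      rw [← show (0 : ℚ → ℚ) (y : ℚ) = 0 from rfl, ← hy]
      push_cast
      refine Finset.sum_congr rfl fun k _ => ?_
      have := hev (y + k)
      push_cast at this
      simp [this]
    exact_mod_cast hq
  have hU : (heckeU d n h : PowerSeries ℤ) =
      (1 - PowerSeries.X) ^ (d + 1) * PowerSeries.mk fun m => expansionCoeff d h (n * m) := by
    ext k
    rw [Polynomial.coeff_coe, heckeU, PowerSeries.coeff_trunc]
    split_ifs with hk
    · rfl
    · exact (coeff_one_sub_pow_mul_mk_eq_zero _ _ hdiff k (by omega)).symm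
  have hinv : (1 - PowerSeries.X : PowerSeries ℤ) ^ (d + 1) *
      (PowerSeries.invOneSubPow ℤ (d + 1)).val = 1 := by
    rw [← PowerSeries.invOneSubPow_inv_eq_one_sub_pow]
    exact (PowerSeries.invOneSubPow ℤ (d + 1)).inv_val
  rw [hU, mul_right_comm, hinv, one_mul]

end

/-! `U_n` is linear in `h`, so everything reduces to the `d + 1` polynomials `U_n t^j`. For `t^j`
the function `g(m)` is the binomial `(m + d - j).choose d`, with leading term `m^d / d!` whatever
`j` is; by Worpitzky's identity `∑ m^d t^m = A_d / (1 - t)^(d+1)`, hence `U_n t^j / n^d → A_d / d!`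
for every `j`. A strict linear inequality true of `A_d` thus holds for all `U_n t^j` once `n` is
large, and passes to nonnegative combinations with `h_0 = 1`; the threshold depends on `d` only.

Applied to values at points separating the roots of `A_d`, this locates the roots of `U_n h`;
negative roots give positivity and strict log-concavity. Applied to coefficients, it gives the
bounds by `m_d h_d(n)` and `h_i(n) < h_{d-i}(n)`.

The inequality `h_{d-i}(n) < h_{i+1}(n)` is invisible at this order, since `A_d` is symmetric. It
rests on the next order, `(U_n t^j - U_n t^(j+1)) / n^(d-1) → (1 - t) A_{d-1} / (d-1)!`, on an exact
reflection symmetry `j ↔ d + 1 - j`, and on summation by parts against the hypothesis on partial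
sums (`sum_mul_pos_of_antisymm`). -/

/-! ### Worpitzky's identity, by sorting words -/

theorem card_filter_strictMono_fin (d N : ℕ) :
    (Finset.univ.filter fun f : Fin d → Fin N => StrictMono f).card = N.choose d := by
  have h : (Finset.powersetCard d (Finset.univ : Finset (Fin N))).card = N.choose d := by simp
  rw [← h]
  refine Finset.card_bij (fun f _ => Finset.univ.image f) ?_ ?_ ?_
  · intro f hf
    have hf' : StrictMono f := by simpa using hf
    simp [Finset.mem_powersetCard, Finset.card_image_of_injective _ hf'.injective]
  · intro f hf g hg hfg
    have hf' : StrictMono f := by simpa using hf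
    have hg' : StrictMono g := by simpa using hg
    have := congrArg (fun s : Finset (Fin N) => (s : Set (Fin N))) hfg
    simp only [Finset.coe_image, Finset.coe_univ, Set.image_univ] at this
    exact (hf'.range_inj hg').1 this
  · intro s hs
    have hs' : s.card = d := (Finset.mem_powersetCard.1 hs).2
    refine ⟨s.orderEmbOfFin hs', by simpa using (s.orderEmbOfFin hs').strictMono, ?_⟩
    apply Finset.coe_injective
    simp

/-- The number of sequences in `Fin m` that increase weakly, and strictly after the positions at
which `P` holds. -/
theorem card_filter_monotone_strict_at (P : ℕ → Prop) [DecidablePred P] (e m : ℕ) :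
    (Finset.univ.filter fun g : Fin (e + 1) → Fin m =>
      ∀ i : Fin e, (g i.castSucc : ℕ) + (if P i then 1 else 0) ≤ g i.succ).card =
      (m + Nat.count (fun k => ¬ P k) e).choose (e + 1) := by
  -- Adding to `g i` the number of weak positions before `i` makes every step strict.
  set c : ℕ → ℕ := Nat.count (fun k => ¬ P k) with hc
  have hc1 : ∀ i, c (i + 1) + (if P i then 1 else 0) = c i + 1 := by
    intro i
    rw [hc, Nat.count_succ]
    split_ifs <;> simp_all
  have hcm : Monotone c := Nat.count_monotone _
  rw [← card_filter_strictMono_fin]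
  refine Finset.card_bij'
    (fun g _ i => ⟨g i + c i, add_lt_add_of_lt_of_le (g i).2 (hcm (Nat.le_of_lt_succ i.2))⟩)
    (fun f hf i => ⟨f i - c i, ?_⟩) ?_ ?_ ?_ ?_
  · have hf' : StrictMono f := by simpa using hf
    have key : ∀ k, ∀ hk : k ≤ e, (f ⟨e - k, by omega⟩ : ℕ) < m + c (e - k) := by
      intro k
      induction k with
      | zero => intro _; exact (f ⟨e, by omega⟩).2
      | succ k ih =>
        intro hk
        have h1 := ih (by omega)
        have h2 : (f ⟨e - (k + 1), by omega⟩ : ℕ) < f ⟨e - k, by omega⟩ :=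
          hf' (Fin.mk_lt_mk.2 (by omega))
        have h3 := hc1 (e - (k + 1))
        rw [show e - (k + 1) + 1 = e - k by omega] at h3
        omega
    have h1 := key (e - i) (by omega)
    simp only [show e - (e - (i : ℕ)) = i by omega, Fin.eta] at h1
    -- Subtraction is truncated, so `f i < m + c i` yields `f i - c i < m` only for positive `m`. If
    -- `m = 0`, then `f` would inject `e + 1` points into `c e ≤ e` values.
    have : 0 < m := by
      rcases Nat.eq_zero_or_pos m with rfl | h
      · have h2 := (f (Fin.last e)).2
        have h3 : c e ≤ e := Nat.count_le _
        have h4 : ∀ k, ∀ hk : k < e + 1, k ≤ (f ⟨k, hk⟩ : ℕ) := by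
          intro k
          induction k with
          | zero => simp
          | succ k ih =>
            intro hk
            have h5 : (f ⟨k, by omega⟩ : ℕ) < f ⟨k + 1, hk⟩ := hf' (Fin.mk_lt_mk.2 (by omega))
            have := ih (by omega)
            omega
        have h5 : e ≤ (f (Fin.last e) : ℕ) := h4 e (by omega)
        omega
      · exact h
    omega
  · intro g hg
    have hg' : ∀ i : Fin e, (g i.castSucc : ℕ) + (if P i then 1 else 0) ≤ g i.succ := by
      simpa using hg
    simp only [Finset.mem_filter, Finset.mem_univ, true_and]
    rw [Fin.strictMono_iff_lt_succ]
    intro i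
    have h1 := hg' i
    have h2 := hc1 i
    simp only [Fin.lt_def, Fin.val_succ, Fin.val_castSucc]
    omega
  · intro f hf
    have hf' : StrictMono f := by simpa using hf
    simp only [Finset.mem_filter, Finset.mem_univ, true_and, Fin.val_succ, Fin.val_castSucc]
    intro i
    have h1 : (f i.castSucc : ℕ) < f i.succ := hf' Fin.castSucc_lt_succ
    have h2 := hc1 i
    have h4 : ∀ k, ∀ hk : k < e + 1, c k ≤ (f ⟨k, hk⟩ : ℕ) := by
      intro k
      induction k with
      | zero => simp [hc]
      | succ k ih =>
        intro hk
        have h5 : (f ⟨k, by omega⟩ : ℕ) < f ⟨k + 1, hk⟩ := hf' (Fin.mk_lt_mk.2 (by omega))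
        have := ih (by omega)
        have := hc1 k
        omega
    have h5 : c i ≤ (f i.castSucc : ℕ) := h4 i (by omega)
    omega
  · intro g hg
    ext i
    simp
  · intro f hf
    have hf' : StrictMono f := by simpa using hf
    have h4 : ∀ k, ∀ hk : k < e + 1, c k ≤ (f ⟨k, hk⟩ : ℕ) := by
      intro k
      induction k with
      | zero => simp [hc]
      | succ k ih =>
        intro hk
        have h5 : (f ⟨k, by omega⟩ : ℕ) < f ⟨k + 1, hk⟩ := hf' (Fin.mk_lt_mk.2 (by omega))
        have := ih (by omega)
        have := hc1 k
        omega
    ext i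
    have := h4 i i.2
    simp only [Fin.eta] at this
    simp [this]

/-- Sorting keeps tied indices in increasing order, so a descent of `w` cannot occur inside a block
of equal values. Conversely, conditions on neighbours propagate along such a block. -/
theorem eq_sort_iff_monotone_strict_at_descents {e m : ℕ} (f : Fin (e + 1) → Fin m)
    (w : Equiv.Perm (Fin (e + 1))) :
    w = Tuple.sort f ↔ ∀ i : Fin e, (f (w i.castSucc) : ℕ) +
      (if w i.succ < w i.castSucc then 1 else 0) ≤ f (w i.succ) := by
  rw [Tuple.eq_sort_iff]
  constructor
  · rintro ⟨h1, h2⟩ i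
    have h3 : (f (w i.castSucc) : ℕ) ≤ f (w i.succ) := h1 (Fin.castSucc_lt_succ (i := i)).le
    split_ifs with h
    · rcases h3.lt_or_eq with h4 | h4
      · omega
      · have := h2 i.castSucc i.succ Fin.castSucc_lt_succ (Fin.ext h4)
        exact absurd h this.asymm
    · simpa using h3
  · intro h
    have hm : Monotone (f ∘ w) := by
      rw [Fin.monotone_iff_le_succ]
      intro i
      have := h i
      simp only [Function.comp, Fin.le_def]
      omega
    refine ⟨hm, fun i j hij hf => ?_⟩
    have key : ∀ k, ∀ hk : (i : ℕ) + k + 1 ≤ j, w i < w ⟨i + k + 1, by omega⟩ := by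
      intro k
      induction k with
      | zero =>
        intro hk
        have h1 := h ⟨i, by omega⟩
        have h2 : f (w i) = f (w ⟨i + 1, by omega⟩) := by
          apply le_antisymm
          · exact hm (Fin.le_def.2 (by simp))
          · rw [hf]; exact hm (Fin.le_def.2 (by simpa using hk))
        simp only [Fin.castSucc_mk, Fin.succ_mk, Fin.eta, ← h2] at h1
        split_ifs at h1 with h3
        · omega
        · have h4 : w i ≠ w ⟨i + 1, by omega⟩ := by
            intro h5
            have := congrArg Fin.val (w.injective h5)
            simp at this
          exact lt_of_le_of_ne (not_lt.1 h3) h4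
      | succ k ih =>
        intro hk
        have h1 := h ⟨i + k + 1, by omega⟩
        have h2 : f (w ⟨i + k + 1, by omega⟩) = f (w ⟨i + k + 1 + 1, by omega⟩) := by
          apply le_antisymm
          · exact hm (Fin.le_def.2 (by simp))
          · refine le_trans (b := f (w j)) ?_ ?_
            · exact hm (Fin.le_def.2 (by simp; omega))
            · rw [← hf]; exact hm (Fin.le_def.2 (by simp; omega))
        simp only [Fin.castSucc_mk, Fin.succ_mk, ← h2] at h1
        split_ifs at h1 with h3
        · omega
        · exact (ih (by omega)).trans_le (not_lt.1 h3)
    have h1 := key (j - i - 1) (by omega)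
    simpa only [show (i : ℕ) + (j - i - 1) + 1 = j by omega, Fin.eta] using h1

theorem card_filter_sort_eq {e : ℕ} (m : ℕ) (w : Equiv.Perm (Fin (e + 1))) :
    (Finset.univ.filter fun f : Fin (e + 1) → Fin m => Tuple.sort f = w).card =
      (m + (e + 1) - (descentCount w + 1)).choose (e + 1) := by
  classical
  let P : ℕ → Prop := fun k => ∃ hk : k + 1 < e + 1, w ⟨k + 1, hk⟩ < w ⟨k, by omega⟩
  have hdes : descentCount w = Nat.count P e := by
    -- The last position is never a descent.
    have h0 : Nat.count P (e + 1) = Nat.count P e := by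
      rw [Nat.count_succ, if_neg (by rintro ⟨h, -⟩; omega), add_zero]
    rw [← h0, Nat.count_eq_card_filter_range, descentCount]
    refine Finset.card_bij (fun k _ => k.val) ?_ ?_ ?_
    · intro k hk
      simp only [Finset.mem_filter, Finset.mem_univ, true_and] at hk
      exact Finset.mem_filter.2 ⟨Finset.mem_range.2 k.2, hk⟩
    · intro a _ b _ h
      exact Fin.ext h
    · intro k hk
      simp only [Finset.mem_filter, Finset.mem_range] at hk
      exact ⟨⟨k, hk.1⟩, Finset.mem_filter.2 ⟨Finset.mem_univ _, hk.2⟩, rfl⟩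
  have hcount : m + (e + 1) - (descentCount w + 1) = m + Nat.count (fun k => ¬ P k) e := by
    have : Nat.count P e + Nat.count (fun k => ¬ P k) e = e := by
      rw [Nat.count_eq_card_filter_range, Nat.count_eq_card_filter_range,
        Finset.card_filter_add_card_filter_not, Finset.card_range]
    omega
  rw [hcount, ← card_filter_monotone_strict_at]
  refine Finset.card_equiv (Equiv.arrowCongr w.symm (Equiv.refl _)) fun f => ?_
  simp only [Finset.mem_filter, Finset.mem_univ, true_and]
  rw [eq_comm, eq_sort_iff_monotone_strict_at_descents]
  refine forall_congr' fun i => ?_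
  have hP : P i ↔ w i.succ < w i.castSucc := by
    constructor
    · rintro ⟨_, h⟩; exact h
    · intro h; exact ⟨by omega, h⟩
  simp [hP]

/-- Worpitzky's identity. -/
theorem sum_perm_choose_descentCount {d : ℕ} (hd : 0 < d) (m : ℕ) :
    ∑ w : Equiv.Perm (Fin d), (m + d - (descentCount w + 1)).choose d = m ^ d := by
  obtain ⟨e, rfl⟩ : ∃ e, d = e + 1 := ⟨d - 1, by omega⟩
  -- Each term counts the words with a given sorting permutation; together they exhaust the `m ^ d`
  -- words.
  simp only [← card_filter_sort_eq]
  rw [← Finset.card_eq_sum_card_fiberwise (f := fun f : Fin (e + 1) → Fin m => Tuple.sort f)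
    (s := Finset.univ) (t := Finset.univ) (by simp)]
  simp

/-! ### Eulerian polynomials: generating function, recurrence, symmetry, unimodality -/

theorem eulerianPoly_coeff (d i : ℕ) :
    (eulerianPoly d).coeff i = if 1 ≤ i ∧ i ≤ d then (eulerianNumber d i : ℤ) else 0 := by
  simp only [eulerianPoly, finsetSum_coeff, coeff_C_mul_X_pow]
  rw [Finset.sum_ite_eq]
  simp

theorem natDegree_eulerianPoly_le (d : ℕ) : (eulerianPoly d).natDegree ≤ d := by
  rw [natDegree_le_iff_coeff_eq_zero]
  intro N hN
  rw [eulerianPoly_coeff, if_neg (by omega)]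

theorem descentCount_lt {d : ℕ} (hd : 0 < d) (w : Equiv.Perm (Fin d)) : descentCount w < d := by
  have : descentCount w < (Finset.univ : Finset (Fin d)).card := by
    refine Finset.card_lt_card (Finset.filter_ssubset.2 ⟨⟨d - 1, by omega⟩, by simp, ?_⟩)
    rintro ⟨h, -⟩
    simp only at h
    omega
  simpa using this

/-- Worpitzky's identity with the permutations grouped by number of descents. -/
theorem expansionCoeff_eulerianPoly {d : ℕ} (hd : 0 < d) (m : ℕ) :
    expansionCoeff d (eulerianPoly d) m = (m : ℤ) ^ d := by
  rw [expansionCoeff_eq_sum _ _ (natDegree_eulerianPoly_le d)]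
  have h := sum_perm_choose_descentCount hd m
  rw [← Finset.sum_fiberwise_of_maps_to (s := Finset.univ) (t := Finset.range (d + 1))
    (g := fun w : Equiv.Perm (Fin d) => descentCount w + 1)
    (fun w _ => by have := descentCount_lt hd w; simp; omega)] at h
  rw [← Nat.cast_pow, ← h, Nat.cast_sum]
  refine Finset.sum_congr rfl fun i hi => ?_
  rw [Finset.mem_range] at hi
  rw [Finset.sum_congr rfl (g := fun _ => (m + d - i).choose d)
    (fun w hw => by rw [(Finset.mem_filter.1 hw).2]), Finset.sum_const, eulerianPoly_coeff]
  rcases Nat.eq_zero_or_pos i with rfl | h0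
  · simp
  · rw [if_pos (by omega)]
    simp [eulerianNumber]

theorem one_sub_X_pow_mul_invOneSubPow (d : ℕ) :
    (1 - PowerSeries.X : PowerSeries ℤ) ^ d * (PowerSeries.invOneSubPow ℤ d).val = 1 := by
  rw [← PowerSeries.invOneSubPow_inv_eq_one_sub_pow]
  exact (PowerSeries.invOneSubPow ℤ d).inv_val

theorem coe_eq_one_sub_X_pow_mul_mk (d : ℕ) (h : ℤ[X]) :
    (h : PowerSeries ℤ) =
      (1 - PowerSeries.X) ^ (d + 1) * PowerSeries.mk (expansionCoeff d h) := by
  have : PowerSeries.mk (expansionCoeff d h) =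
      (h : PowerSeries ℤ) * (PowerSeries.invOneSubPow ℤ (d + 1)).val := by
    ext m
    simp [expansionCoeff]
  rw [this, mul_left_comm, one_sub_X_pow_mul_invOneSubPow, mul_one]

theorem coe_eulerianPoly {d : ℕ} (hd : 0 < d) :
    (eulerianPoly d : PowerSeries ℤ) =
      (1 - PowerSeries.X) ^ (d + 1) * PowerSeries.mk fun m => (m : ℤ) ^ d := by
  rw [coe_eq_one_sub_X_pow_mul_mk d, funext (expansionCoeff_eulerianPoly hd)]

/-- Apply `t d/dt` to `∑ m^d t^m = A_d / (1 - t)^(d+1)`. -/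
theorem eulerianPoly_succ {d : ℕ} (hd : 0 < d) :
    eulerianPoly (d + 1) = X * ((1 - X) * derivative (eulerianPoly d) +
      ((d : ℤ[X]) + 1) * eulerianPoly d) := by
  apply Polynomial.coe_injective ℤ
  have hF : (PowerSeries.mk fun m => (m : ℤ) ^ (d + 1)) =
      PowerSeries.X * PowerSeries.derivative ℤ (PowerSeries.mk fun m => (m : ℤ) ^ d) := by
    ext m
    rcases m with _ | m
    · simp
    · rw [PowerSeries.coeff_succ_X_mul, PowerSeries.coeff_derivative]
      simp [pow_succ]
  have hA := coe_eulerianPoly hd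
  have hder : ((derivative (eulerianPoly d) : ℤ[X]) : PowerSeries ℤ) =
      (1 - PowerSeries.X) ^ (d + 1) *
        PowerSeries.derivative ℤ (PowerSeries.mk fun m => (m : ℤ) ^ d) -
      ((d : PowerSeries ℤ) + 1) * (1 - PowerSeries.X) ^ d *
        PowerSeries.mk fun m => (m : ℤ) ^ d := by
    rw [← PowerSeries.derivative_coe, hA, Derivation.leibniz, Derivation.leibniz_pow]
    simp only [map_sub, PowerSeries.derivative_X, PowerSeries.derivative_one, smul_eq_mul,
      nsmul_eq_mul, Nat.add_sub_cancel]
    push_cast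
    ring
  have hcast : ((d : ℤ[X]) : PowerSeries ℤ) = d :=
    map_natCast Polynomial.coeToPowerSeries.ringHom d
  push_cast
  rw [hder, coe_eulerianPoly (show 0 < d + 1 by omega), hA, hF, hcast]
  ring

theorem eulerianPoly_one : eulerianPoly 1 = X := by
  have : eulerianNumber 1 1 = 1 := by decide
  simp [eulerianPoly, this]

theorem eulerianPoly_coeff_zero (d : ℕ) : (eulerianPoly d).coeff 0 = 0 := by
  simp [eulerianPoly_coeff]

theorem eulerianPoly_coeff_of_lt {d i : ℕ} (h : d < i) : (eulerianPoly d).coeff i = 0 := by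
  rw [eulerianPoly_coeff, if_neg (by omega)]

theorem eulerianPoly_coeff_succ {d : ℕ} (hd : 0 < d) (i : ℕ) :
    (eulerianPoly (d + 1)).coeff (i + 1) =
      (i + 1) * (eulerianPoly d).coeff (i + 1) + (d + 1 - i) * (eulerianPoly d).coeff i := by
  rw [eulerianPoly_succ hd, coeff_X_mul, coeff_add, sub_mul, one_mul, coeff_sub, coeff_derivative,
    add_mul, one_mul, coeff_add, ← map_natCast (C : ℤ →+* ℤ[X]), coeff_C_mul]
  rcases i with _ | i
  · simp; ring
  · rw [coeff_X_mul, coeff_derivative]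
    push_cast
    simp
    ring

theorem eulerianPoly_coeff_symm {d : ℕ} (hd : 0 < d) {i j : ℕ} (hij : i + j = d + 1) :
    (eulerianPoly d).coeff i = (eulerianPoly d).coeff j := by
  induction d, hd using Nat.le_induction generalizing i j with
  | base =>
    rw [eulerianPoly_one]
    obtain ⟨rfl, rfl⟩ | ⟨rfl, rfl⟩ | ⟨rfl, rfl⟩ :
      i = 0 ∧ j = 2 ∨ i = 1 ∧ j = 1 ∨ i = 2 ∧ j = 0 := by omega
    all_goals simp [coeff_X]
  | succ d hd ih =>
    rcases i with _ | i
    · rw [eulerianPoly_coeff_zero, eulerianPoly_coeff_of_lt (by omega)]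
    rcases j with _ | j
    · rw [eulerianPoly_coeff_zero, eulerianPoly_coeff_of_lt (by omega)]
    rw [eulerianPoly_coeff_succ hd, eulerianPoly_coeff_succ hd,
      ih (show i + 1 + j = d + 1 by omega), ih (show i + (j + 1) = d + 1 by omega)]
    have h1 : (i : ℤ) + j = d := by omega
    rw [show (d : ℤ) + 1 - i = j + 1 by omega, show (d : ℤ) + 1 - j = i + 1 by omega]
    ring

theorem eulerianPoly_coeff_self {d : ℕ} (hd : 0 < d) : (eulerianPoly d).coeff d = 1 := by
  induction d, hd using Nat.le_induction with
  | base => simp [eulerianPoly_one]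
  | succ d hd ih =>
    rw [eulerianPoly_coeff_succ hd, ih, eulerianPoly_coeff_of_lt (Nat.lt_succ_self d)]
    ring

theorem natDegree_eulerianPoly {d : ℕ} (hd : 0 < d) : (eulerianPoly d).natDegree = d :=
  natDegree_eq_of_le_of_coeff_ne_zero (natDegree_eulerianPoly_le d)
    (by simp [eulerianPoly_coeff_self hd])

theorem eulerianPoly_monic {d : ℕ} (hd : 0 < d) : (eulerianPoly d).Monic := by
  rw [Monic, leadingCoeff, natDegree_eulerianPoly hd, eulerianPoly_coeff_self hd]

theorem eulerianPoly_coeff_lt_succ {d : ℕ} (hd : 0 < d) {i : ℕ} (hi : 2 * i + 1 ≤ d) :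
    (eulerianPoly d).coeff i < (eulerianPoly d).coeff (i + 1) := by
  induction d, hd using Nat.le_induction generalizing i with
  | base =>
    obtain rfl : i = 0 := by omega
    simp [eulerianPoly_one]
  | succ d hd ih =>
    -- Equality occurs in the middle, when `2 * i = d`.
    have h1 : (eulerianPoly d).coeff i ≤ (eulerianPoly d).coeff (i + 1) := by
      rcases (show 2 * i + 1 ≤ d ∨ 2 * i = d by omega) with h | h
      · exact (ih h).le
      · exact (eulerianPoly_coeff_symm hd (by omega)).le
    rcases i with _ | i
    · rw [eulerianPoly_coeff_zero, eulerianPoly_coeff_succ hd, eulerianPoly_coeff_zero]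
      have := ih (i := 0) (by omega)
      rw [eulerianPoly_coeff_zero] at this
      simpa using this
    · have h2 := ih (i := i) (by omega)
      rw [eulerianPoly_coeff_succ hd, eulerianPoly_coeff_succ hd]
      -- With `a` the coefficients in degree `d`, the recurrence makes the new difference equal to
      -- `(i+2)(a_{i+2} - a_{i+1}) + (d+1-i)(a_{i+1} - a_i)`.
      have hid : (i : ℤ) < d := by omega
      push_cast
      nlinarith [mul_nonneg (show (0 : ℤ) ≤ i + 1 + 1 by omega) (sub_nonneg.2 h1),
        mul_pos (show (0 : ℤ) < d + 1 - i by omega) (sub_pos.2 h2)]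

theorem eulerianPoly_coeff_lt_of_lt {d : ℕ} (hd : 0 < d) {i : ℕ} (hi : i < d - i) :
    (eulerianPoly d).coeff i < (eulerianPoly d).coeff (d - i) := by
  rw [← eulerianPoly_coeff_symm hd (show i + 1 + (d - i) = d + 1 by omega)]
  exact eulerianPoly_coeff_lt_succ hd (by omega)

/-! ### Real roots from sign changes; the roots of the Eulerian polynomial -/

/-- A polynomial of degree at most `d` whose values alternate in sign at `d + 1` points, and are
positive at the last one, has `d` simple real roots, which interlace these points. -/
theorem exists_roots_of_alternating {d : ℕ} {p : ℝ[X]} (hp : p.natDegree ≤ d)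
    {s : Fin (d + 1) → ℝ} (hs : StrictMono s)
    (h : ∀ i : Fin (d + 1), 0 < (-1) ^ (d - (i : ℕ)) * p.eval (s i)) :
    ∃ ρ : Fin d → ℝ, StrictMono ρ ∧ (∀ i, s i.castSucc < ρ i ∧ ρ i < s i.succ) ∧
      p.roots = Finset.univ.val.map ρ := by
  have hex : ∀ i : Fin d, ∃ x, (s i.castSucc < x ∧ x < s i.succ) ∧ p.eval x = 0 := by
    intro i
    set c : ℝ := (-1) ^ (d - (i + 1) : ℕ) with hc
    have h1 := h i.castSucc
    have h2 := h i.succ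
    rw [Fin.val_castSucc, show d - (i : ℕ) = d - (i + 1) + 1 by omega, pow_succ, ← hc] at h1
    rw [Fin.val_succ, ← hc] at h2
    have hcont : ContinuousOn (fun x => c * p.eval x) (Set.Icc (s i.castSucc) (s i.succ)) := by
      fun_prop
    obtain ⟨x, hx, hx0⟩ := intermediate_value_Ioo (hs Fin.castSucc_lt_succ).le hcont
      (show (0 : ℝ) ∈ _ from ⟨by linarith, h2⟩)
    have hc0 : c ≠ 0 := by rw [hc]; exact pow_ne_zero _ (by norm_num)
    exact ⟨x, hx, (mul_eq_zero.1 hx0).resolve_left hc0⟩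
  choose ρ hρ hρ0 using hex
  have hmono : StrictMono ρ := by
    intro i j hij
    exact (hρ i).2.trans_le
      ((hs.monotone (Fin.le_def.2 (by simpa using hij))).trans (hρ j).1.le)
  refine ⟨ρ, hmono, hρ, ?_⟩
  have hp0 : p ≠ 0 := by
    rintro rfl
    simpa using h 0
  -- The `d` distinct roots already found exhaust the degree, so all are simple.
  symm
  apply Multiset.eq_of_le_of_card_le
  · rw [Multiset.le_iff_subset ((Multiset.nodup_map_iff_of_injective hmono.injective).2
      Finset.univ.nodup)]
    intro x hx
    obtain ⟨i, -, rfl⟩ := Multiset.mem_map.1 hx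
    rw [mem_roots hp0]
    exact hρ0 i
  · simpa using (card_roots' p).trans hp

theorem strictMono_eq_of_map_univ_eq {d : ℕ} {ρ σ : Fin d → ℝ} (hρ : StrictMono ρ)
    (hσ : StrictMono σ) (h : (Finset.univ : Finset (Fin d)).val.map ρ = Finset.univ.val.map σ) :
    ρ = σ := by
  refine (hρ.range_inj hσ).1 (Set.ext fun x => ?_)
  have := congrArg (x ∈ ·) h
  simpa using this

theorem sign_mul_prod_pos {ι : Type*} (S : Finset ι) (f : ι → ℝ)
    (hf : ∀ k ∈ S, f k ≠ 0) : 0 < (-1) ^ (S.filter fun k => f k < 0).card * ∏ k ∈ S, f k := by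
  classical
  induction S using Finset.induction_on with
  | empty => simp
  | insert a S ha ih =>
    have h1 := ih fun k hk => hf k (Finset.mem_insert_of_mem hk)
    rw [Finset.filter_insert, Finset.prod_insert ha]
    split_ifs with h
    · rw [Finset.card_insert_of_notMem (by simp [ha]), pow_succ]
      nlinarith [mul_pos (neg_pos.2 h) h1]
    · have h2 : 0 < f a := lt_of_le_of_ne (not_lt.1 h) (hf a (Finset.mem_insert_self _ _)).symm
      nlinarith [mul_pos h2 h1]

theorem sign_mul_eval_prod_X_sub_C_pos {d : ℕ} {ρ : Fin d → ℝ} (i : Fin d) {x : ℝ}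
    (h1 : ∀ k, k < i → ρ k < x) (h2 : ∀ k, i ≤ k → x < ρ k) :
    0 < (-1) ^ (d - i : ℕ) * (∏ k, (X - C (ρ k))).eval x := by
  have h := sign_mul_prod_pos Finset.univ (fun k => x - ρ k) fun k _ => by
    rcases lt_or_ge k i with hk | hk
    · exact (sub_pos.2 (h1 k hk)).ne'
    · exact (sub_neg.2 (h2 k hk)).ne
  have hS : (Finset.univ.filter fun k => x - ρ k < 0) = Finset.Ici i := by
    ext k
    simp only [Finset.mem_filter, Finset.mem_univ, true_and, Finset.mem_Ici, sub_neg]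
    exact ⟨fun hk => not_lt.1 fun hki => hk.asymm (h1 k hki), h2 k⟩
  rw [hS, Fin.card_Ici] at h
  simpa [eval_prod] using h

theorem sign_mul_eval_derivative_prod_X_sub_C_pos {d : ℕ} {ρ : Fin d → ℝ} (hρ : StrictMono ρ)
    (i : Fin d) :
    0 < (-1) ^ (d - 1 - i : ℕ) * (derivative (∏ k, (X - C (ρ k)))).eval (ρ i) := by
  have h := sign_mul_prod_pos (Finset.univ.erase i) (fun k => ρ i - ρ k) fun k hk =>
    sub_ne_zero.2 (hρ.injective.ne (Finset.ne_of_mem_erase hk).symm)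
  have hS : ((Finset.univ.erase i).filter fun k => ρ i - ρ k < 0) = Finset.Ioi i := by
    ext k
    simp only [Finset.mem_filter, Finset.mem_univ, Finset.mem_erase, Finset.mem_Ioi, sub_neg,
      hρ.lt_iff_lt, and_true]
    exact ⟨fun hk => hk.2, fun hk => ⟨hk.ne', hk⟩⟩
  rw [hS, Fin.card_Ioi] at h
  have hder : (derivative (∏ k, (X - C (ρ k)))).eval (ρ i) =
      ∏ k ∈ Finset.univ.erase i, (ρ i - ρ k) := by
    rw [← Finset.mul_prod_erase _ _ (Finset.mem_univ i), derivative_mul]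
    simp [eval_prod]
  rwa [hder]

theorem exists_lt_sign_mul_eval_pos {p : ℝ[X]} (hp : p.Monic) (hp0 : p.natDegree ≠ 0) (a : ℝ) :
    ∃ x < a, 0 < (-1) ^ p.natDegree * p.eval x := by
  set q : ℝ[X] := C ((-1) ^ p.natDegree) * p.comp (-X) with hq
  have hdeg : (-X : ℝ[X]).natDegree = 1 := by simp
  have hc : ((-1 : ℝ) ^ p.natDegree) ≠ 0 := pow_ne_zero _ (by norm_num)
  have hlc : q.leadingCoeff = 1 := by
    rw [hq, leadingCoeff_mul, leadingCoeff_C, leadingCoeff_comp (by simp), hp.leadingCoeff]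
    simp [← mul_pow]
  have hnd : q.natDegree = p.natDegree := by
    rw [hq, natDegree_C_mul hc, natDegree_comp, hdeg, mul_one]
  have ht := q.tendsto_atTop_of_leadingCoeff_nonneg
    (natDegree_pos_iff_degree_pos.1 (by omega)) (by simp [hlc])
  obtain ⟨y, hy1, hy2⟩ := ((ht.eventually_gt_atTop 0).and
    (Filter.eventually_gt_atTop (-a))).exists
  exact ⟨-y, by linarith, by simpa [hq, eval_comp] using hy1⟩

/-- Write the next Eulerian polynomial as `X * B`. At a root `r ≤ 0` of the present one, `A`, the
recurrence gives `B(r) = (1 - r) A'(r)`, and `A'` alternates in sign along simple roots. One more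
point far to the left supplies the remaining sign change, so the roots of `B` interlace and are
negative; the factor `X` adds the root `0`. -/
theorem eulerianPoly_eq_prod (e : ℕ) : ∃ ρ : Fin (e + 1) → ℝ, StrictMono ρ ∧
    ρ (Fin.last e) = 0 ∧
    (eulerianPoly (e + 1)).map (Int.castRingHom ℝ) = ∏ k, (X - C (ρ k)) := by
  induction e with
  | zero =>
    exact ⟨fun _ => 0, fun i j h => by omega, rfl, by simp [eulerianPoly_one]⟩
  | succ e ih =>
    obtain ⟨ρ, hρ, hlast, hA⟩ := ih
    set A := (eulerianPoly (e + 1)).map (Int.castRingHom ℝ) with hA'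
    set B : ℝ[X] := (1 - X) * derivative A + ((e : ℝ[X]) + 2) * A with hB
    have hXB : (eulerianPoly (e + 1 + 1)).map (Int.castRingHom ℝ) = X * B := by
      rw [eulerianPoly_succ (Nat.succ_pos e), hB, hA']
      simp only [Polynomial.map_mul, Polynomial.map_add, Polynomial.map_sub, map_X,
        Polynomial.map_one, derivative_map, Polynomial.map_natCast]
      push_cast
      ring
    have hmon : (X * B).Monic := hXB ▸ (eulerianPoly_monic (Nat.succ_pos (e + 1))).map _
    have hBmon : B.Monic := monic_X.of_mul_monic_left hmon
    have hBdeg : B.natDegree = e + 1 := by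
      have h1 : (X * B).natDegree = e + 1 + 1 := by
        rw [← hXB, (eulerianPoly_monic (Nat.succ_pos (e + 1))).natDegree_map,
          natDegree_eulerianPoly (Nat.succ_pos (e + 1))]
      rw [monic_X.natDegree_mul hBmon, natDegree_X] at h1
      omega
    obtain ⟨x, hx, hxB⟩ := exists_lt_sign_mul_eval_pos hBmon (by omega) (ρ 0)
    rw [hBdeg] at hxB
    have hneg : ∀ i, ρ i ≤ 0 := fun i => hlast ▸ hρ.monotone (Fin.le_last i)
    have hs : StrictMono (Fin.cons x ρ : Fin (e + 1 + 1) → ℝ) := by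
      rw [Fin.strictMono_iff_lt_succ]
      intro i
      refine Fin.cases ?_ (fun i => ?_) i
      · simpa using hx
      · rw [← Fin.succ_castSucc, Fin.cons_succ, Fin.cons_succ]
        exact hρ Fin.castSucc_lt_succ
    obtain ⟨σ, hσ, hσs, hroots⟩ := exists_roots_of_alternating hBdeg.le hs (by
      intro i
      refine Fin.cases ?_ (fun i => ?_) i
      · simpa using hxB
      · have h1 := sign_mul_eval_derivative_prod_X_sub_C_pos hρ i
        have h2 : A.eval (ρ i) = 0 := by
          rw [hA, eval_prod]
          exact Finset.prod_eq_zero (Finset.mem_univ i) (by simp)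
        rw [← hA] at h1
        rw [Fin.cons_succ, Fin.val_succ, show e + 1 - (i + 1 : ℕ) = e + 1 - 1 - i by omega, hB,
          eval_add, eval_mul, eval_mul, h2, mul_zero, add_zero, mul_left_comm]
        refine mul_pos ?_ h1
        have := hneg i
        simp
        linarith)
    have hσ0 : ∀ i, σ i < 0 := fun i => by
      have := (hσs i).2
      rw [Fin.cons_succ] at this
      exact this.trans_le (hneg i)
    have hBprod : B = ∏ k, (X - C (σ k)) := by
      have := prod_multiset_X_sub_C_of_monic_of_roots_card_eq hBmon (by rw [hroots]; simp [hBdeg])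
      rw [← this, hroots, Multiset.map_map]
      rfl
    refine ⟨Fin.snoc σ 0, ?_, by simp, ?_⟩
    · rw [Fin.strictMono_iff_lt_succ]
      intro i
      refine Fin.lastCases ?_ (fun i => ?_) i
      · rw [Fin.succ_last, Fin.snoc_last, Fin.snoc_castSucc]
        exact hσ0 _
      · rw [Fin.succ_castSucc, Fin.snoc_castSucc, Fin.snoc_castSucc]
        exact hσ Fin.castSucc_lt_succ
    · rw [hXB, hBprod, Fin.prod_univ_castSucc (n := e + 1)]
      simp [mul_comm]

/-! ### Positivity and log-concavity from negative roots -/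

/-- Multiplication by `X + r` with `r > 0` preserves all three properties: the log-concavity gap is
a quadratic in `r` with nonnegative coefficients and positive constant term, apart from the lowest
index, which is checked directly. -/
theorem coeff_prod_X_sub_C_of_neg {n : ℕ} (ρ : Fin n → ℝ) (hρ : ∀ i, ρ i < 0) :
    (∀ i ≤ n, 0 < (∏ k, (X - C (ρ k))).coeff i) ∧
    (∀ i, n < i → (∏ k, (X - C (ρ k))).coeff i = 0) ∧
    ∀ i, i + 1 ≤ n → (∏ k, (X - C (ρ k))).coeff i * (∏ k, (X - C (ρ k))).coeff (i + 2) <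
      (∏ k, (X - C (ρ k))).coeff (i + 1) ^ 2 := by
  induction n with
  | zero =>
    refine ⟨fun i hi => ?_, fun i hi => ?_, fun i hi => ?_⟩
    · obtain rfl : i = 0 := by omega
      simp
    · simp [coeff_one, show i ≠ 0 by omega]
    · omega
  | succ n ih =>
    obtain ⟨h1, h2, h3⟩ := ih (fun k => ρ k.castSucc) fun k => hρ _
    rw [Fin.prod_univ_castSucc]
    set p : ℝ[X] := ∏ k : Fin n, (X - C (ρ k.castSucc)) with hp
    obtain ⟨r, hr, hr'⟩ : ∃ r : ℝ, 0 < r ∧ ρ (Fin.last n) = -r :=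
      ⟨-ρ (Fin.last n), neg_pos.2 (hρ _), by simp⟩
    have hnn : ∀ i, 0 ≤ p.coeff i := fun i => by
      rcases le_or_gt i n with h | h
      · exact (h1 i h).le
      · exact (h2 i h).ge
    have hc0 : (p * (X - C (ρ (Fin.last n)))).coeff 0 = r * p.coeff 0 := by
      rw [hr']; simp [mul_coeff_zero, mul_comm]
    have hcs : ∀ i, (p * (X - C (ρ (Fin.last n)))).coeff (i + 1) =
        p.coeff i + r * p.coeff (i + 1) := by
      intro i
      rw [coeff_mul_X_sub_C, hr']
      ring
    refine ⟨fun i hi => ?_, fun i hi => ?_, fun i hi => ?_⟩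
    · rcases i with _ | i
      · rw [hc0]; exact mul_pos hr (h1 0 (by omega))
      · rw [hcs]
        have := h1 i (by omega)
        have := mul_nonneg hr.le (hnn (i + 1))
        linarith
    · rcases i with _ | i
      · omega
      · rw [hcs, h2 i (by omega), h2 (i + 1) (by omega)]; simp
    · have hi0 := h1 i (by omega)
      have hlc : p.coeff i * p.coeff (i + 2) ≤ p.coeff (i + 1) ^ 2 := by
        rcases le_or_gt (i + 1) n with h | h
        · exact (h3 i h).le
        · rw [h2 (i + 2) (by omega)]; simp; positivity
      rcases i with _ | i
      · rw [hc0, hcs, hcs]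
        nlinarith [mul_nonneg (sq_nonneg r) (sub_nonneg.2 hlc), mul_nonneg hr.le (mul_nonneg hi0.le
          (hnn 1)), mul_pos hi0 hi0]
      · have hlc' := h3 i (by omega)
        -- This controls the term linear in `r`: multiply two consecutive log-concavity inequalities
        -- and cancel the positive middle coefficients.
        have hmid : p.coeff i * p.coeff (i + 1 + 2) ≤ p.coeff (i + 1) * p.coeff (i + 2) := by
          rcases le_or_gt (i + 2) n with h | h
          · have h4 := h1 (i + 2) h
            refine le_of_mul_le_mul_right ?_ (mul_pos hi0 h4)
            have := mul_le_mul hlc'.le hlc (mul_nonneg (hnn _) (hnn _)) (sq_nonneg _)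
            linarith
          · rw [h2 (i + 1 + 2) (by omega), mul_zero]
            exact mul_nonneg (hnn _) (hnn _)
        rw [hcs, hcs, hcs]
        simp only [show i + 1 + 1 = i + 2 by omega] at *
        nlinarith [mul_nonneg (sq_nonneg r) (sub_nonneg.2 hlc), mul_nonneg hr.le
          (sub_nonneg.2 hmid)]

theorem coeff_pos_and_strict_log_concave {d : ℕ} {p : ℝ[X]} (hp : 0 < p.coeff d)
    (hd : p.natDegree ≤ d) {β : Fin d → ℝ} (hβ : ∀ i, β i < 0)
    (hroots : p.roots = Finset.univ.val.map β) :
    (∀ i ≤ d, 0 < p.coeff i) ∧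
      ∀ i, i + 1 ≤ d → p.coeff i * p.coeff (i + 2) < p.coeff (i + 1) ^ 2 := by
  have hdeg : p.natDegree = d := natDegree_eq_of_le_of_coeff_ne_zero hd hp.ne'
  have hlc : p.leadingCoeff = p.coeff d := by rw [leadingCoeff, hdeg]
  have hprod : p = C (p.coeff d) * ∏ k, (X - C (β k)) := by
    have := C_leadingCoeff_mul_prod_multiset_X_sub_C (p := p) (by rw [hroots]; simp [hdeg])
    rw [hroots, Multiset.map_map, hlc] at this
    exact this.symm
  obtain ⟨h1, -, h3⟩ := coeff_prod_X_sub_C_of_neg β hβ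
  generalize p.coeff d = c at hp hprod
  subst hprod
  refine ⟨fun i hi => ?_, fun i hi => ?_⟩
  · rw [coeff_C_mul]
    exact mul_pos hp (h1 i hi)
  · simp only [coeff_C_mul]
    nlinarith [mul_pos (mul_pos hp hp) (sub_pos.2 (h3 i hi))]

/-! ### Linearity of `U_n` and asymptotics on monomials -/

theorem natDegree_heckeU_le (d n : ℕ) (h : ℤ[X]) : (heckeU d n h).natDegree ≤ d :=
  Nat.lt_succ_iff.1 (PowerSeries.natDegree_trunc_lt _ _)

theorem coeff_heckeU_eq_coeff_mul {d i : ℕ} (hi : i ≤ d) (n : ℕ) (h : ℤ[X]) :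
    (heckeU d n h).coeff i = PowerSeries.coeff i
      ((1 - PowerSeries.X) ^ (d + 1) * PowerSeries.mk fun m => expansionCoeff d h (n * m)) := by
  rw [heckeU, PowerSeries.coeff_trunc, if_pos (by omega)]

theorem coeff_heckeU {d i : ℕ} (hi : i ≤ d) (n : ℕ) (h : ℤ[X]) :
    (heckeU d n h).coeff i = ∑ p ∈ Finset.HasAntidiagonal.antidiagonal i,
      PowerSeries.coeff p.1 ((1 - PowerSeries.X : PowerSeries ℤ) ^ (d + 1)) *
        expansionCoeff d h (n * p.2) := by
  rw [coeff_heckeU_eq_coeff_mul hi, PowerSeries.coeff_mul]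
  simp

theorem expansionCoeff_X_pow {d j : ℕ} (hj : j ≤ d) (m : ℕ) :
    expansionCoeff d (X ^ j) m = ((m + (d - j)).choose d : ℤ) := by
  rw [expansionCoeff_eq_sum _ _ (by simpa using hj), Finset.sum_eq_single j]
  · simp [Nat.add_sub_assoc hj]
  · intro b _ hb
    simp [coeff_X_pow, hb]
  · intro h
    simp at h
    omega

theorem coeff_heckeU_eq_sum {d i : ℕ} (hi : i ≤ d) (n : ℕ) {h : ℤ[X]} (hh : h.natDegree ≤ d) :
    (heckeU d n h).coeff i =
      ∑ j ∈ Finset.range (d + 1), h.coeff j * (heckeU d n (X ^ j)).coeff i := by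
  simp only [coeff_heckeU hi, Finset.mul_sum]
  rw [Finset.sum_comm]
  refine Finset.sum_congr rfl fun p _ => ?_
  rw [expansionCoeff_eq_sum _ _ hh, Finset.mul_sum]
  refine Finset.sum_congr rfl fun j hj => ?_
  have hj' : j ≤ d := by simpa [Nat.lt_succ_iff] using hj
  rw [expansionCoeff_X_pow hj', Nat.add_sub_assoc hj']
  ring

theorem coeff_zero_heckeU (d n : ℕ) {h : ℤ[X]} (hh : h.natDegree ≤ d) :
    (heckeU d n h).coeff 0 = h.coeff 0 := by
  rw [coeff_heckeU (Nat.zero_le d)]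
  simp only [Finset.HasAntidiagonal.antidiagonal_zero, Finset.sum_singleton, mul_zero]
  rw [expansionCoeff_eq_sum _ _ hh, Finset.sum_range_succ', Finset.sum_eq_zero]
  · simp
  · intro j hj
    rw [Nat.choose_eq_zero_of_lt (by simp at hj; omega)]
    simp

theorem eval_heckeU_eq_sum (d n : ℕ) {h : ℤ[X]} (hh : h.natDegree ≤ d) (x : ℝ) :
    ((heckeU d n h).map (Int.castRingHom ℝ)).eval x =
      ∑ j ∈ Finset.range (d + 1), (h.coeff j : ℝ) *
        ((heckeU d n (X ^ j)).map (Int.castRingHom ℝ)).eval x := by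
  have hev : ∀ q : ℤ[X], ((heckeU d n q).map (Int.castRingHom ℝ)).eval x =
      ∑ i ∈ Finset.range (d + 1), ((heckeU d n q).coeff i : ℝ) * x ^ i := fun q => by
    rw [eval_eq_sum_range' (Nat.lt_succ_of_le (natDegree_map_le.trans
      (natDegree_heckeU_le d n q)))]
    simp
  simp only [hev, Finset.mul_sum]
  rw [Finset.sum_comm]
  refine Finset.sum_congr rfl fun i hi => ?_
  rw [coeff_heckeU_eq_sum (by simpa [Nat.lt_succ_iff] using hi) n hh]
  push_cast
  rw [Finset.sum_mul]
  simp only [mul_assoc]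

theorem tendsto_choose_div_pow (m a e : ℕ) :
    Filter.Tendsto (fun n : ℕ => ((n * m + a).choose e : ℝ) / (n : ℝ) ^ e) Filter.atTop
      (nhds ((m : ℝ) ^ e / e.factorial)) := by
  have h1 : ∀ k : ℕ, Filter.Tendsto (fun n : ℕ => ((n * m + a - k : ℕ) : ℝ) / n) Filter.atTop
      (nhds (m : ℝ)) := by
    intro k
    have hc : ∀ c : ℝ, Filter.Tendsto (fun n : ℕ => (m : ℝ) + c / n) Filter.atTop
        (nhds (m : ℝ)) := fun c => by
      simpa using (tendsto_const_div_atTop_nhds_zero_nat c).const_add (m : ℝ)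
    -- Squeezing between `m - k/n` and `m + a/n` absorbs the truncated subtraction.
    refine tendsto_of_tendsto_of_tendsto_of_le_of_le' (hc (-k)) (hc a) ?_ ?_
    · filter_upwards [Filter.eventually_gt_atTop 0] with n hn
      have hn' : (0 : ℝ) < n := by exact_mod_cast hn
      rw [le_div_iff₀ hn', add_mul, div_mul_cancel₀ _ hn'.ne']
      have : ((n * m + a : ℕ) : ℝ) ≤ ((n * m + a - k : ℕ) : ℝ) + k := by
        exact_mod_cast (by omega : n * m + a ≤ n * m + a - k + k)
      push_cast at this
      nlinarith [Nat.cast_nonneg (α := ℝ) a]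
    · filter_upwards [Filter.eventually_gt_atTop 0] with n hn
      have hn' : (0 : ℝ) < n := by exact_mod_cast hn
      rw [div_le_iff₀ hn', add_mul, div_mul_cancel₀ _ hn'.ne']
      have : ((n * m + a - k : ℕ) : ℝ) ≤ ((n * m + a : ℕ) : ℝ) := by
        exact_mod_cast Nat.sub_le _ _
      push_cast at this
      nlinarith
  have h2 := (tendsto_finsetProd (Finset.range e) fun k _ => h1 k).div_const (e.factorial : ℝ)
  simp only [Finset.prod_const, Finset.card_range] at h2
  refine h2.congr fun n => ?_
  rw [Finset.prod_div_distrib, Finset.prod_const, Finset.card_range, ← Nat.cast_prod,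
    ← Nat.descFactorial_eq_prod_range, Nat.descFactorial_eq_factorial_mul_choose]
  have : (e.factorial : ℝ) ≠ 0 := by positivity
  push_cast
  field_simp

/-- The exponent `e` is kept apart from `q` because it serves twice: with `e = d` for the leading
order and with `e = d - 1` for differences. -/
theorem tendsto_sum_antidiagonal_choose_div_pow (q : PowerSeries ℤ) (i a e : ℕ) :
    Filter.Tendsto (fun n : ℕ => ((∑ p ∈ Finset.HasAntidiagonal.antidiagonal i, PowerSeries.coeff p.1 q *
        ((n * p.2 + a).choose e : ℤ) : ℤ) : ℝ) / (n : ℝ) ^ e) Filter.atTop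
      (nhds (((PowerSeries.coeff i (q * PowerSeries.mk fun m => (m : ℤ) ^ e) : ℤ) : ℝ) /
        e.factorial)) := by
  rw [PowerSeries.coeff_mul]
  push_cast
  simp only [Finset.sum_div, PowerSeries.coeff_mk, Int.cast_pow, Int.cast_natCast, mul_div_assoc]
  exact tendsto_finsetSum _ fun p _ => (tendsto_choose_div_pow _ _ _).const_mul _

theorem tendsto_coeff_heckeU_X_pow {d i j : ℕ} (hd : 0 < d) (hi : i ≤ d) (hj : j ≤ d) :
    Filter.Tendsto (fun n : ℕ => ((heckeU d n (X ^ j)).coeff i : ℝ) / (n : ℝ) ^ d) Filter.atTop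
      (nhds (((eulerianPoly d).coeff i : ℝ) / d.factorial)) := by
  have h := tendsto_sum_antidiagonal_choose_div_pow
    ((1 - PowerSeries.X : PowerSeries ℤ) ^ (d + 1)) i (d - j) d
  rw [← coe_eulerianPoly hd, Polynomial.coeff_coe] at h
  simpa only [coeff_heckeU hi, expansionCoeff_X_pow hj] using h

/-- By Pascal's rule the difference of the two binomials is a binomial of lower index `e`; one of
the `e + 2` factors `1 - t` is then left over. -/
theorem tendsto_coeff_heckeU_X_pow_sub {e i j : ℕ} (he : 0 < e) (hi : i ≤ e + 1) (hj : j ≤ e) :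
    Filter.Tendsto (fun n : ℕ => (((heckeU (e + 1) n (X ^ j)).coeff i -
        (heckeU (e + 1) n (X ^ (j + 1))).coeff i : ℤ) : ℝ) / (n : ℝ) ^ e) Filter.atTop
      (nhds ((((1 - X) * eulerianPoly e).coeff i : ℝ) / e.factorial)) := by
  have h := tendsto_sum_antidiagonal_choose_div_pow
    ((1 - PowerSeries.X : PowerSeries ℤ) ^ (e + 1 + 1)) i (e - j) e
  have hcoe : (1 - PowerSeries.X : PowerSeries ℤ) ^ (e + 1 + 1) *
      (PowerSeries.mk fun m => (m : ℤ) ^ e) = (((1 - X) * eulerianPoly e : ℤ[X]) :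
        PowerSeries ℤ) := by
    push_cast
    rw [coe_eulerianPoly he]
    ring
  rw [hcoe, Polynomial.coeff_coe] at h
  refine h.congr fun n => ?_
  congr 2
  rw [coeff_heckeU hi, coeff_heckeU hi, ← Finset.sum_sub_distrib]
  refine Finset.sum_congr rfl fun p _ => ?_
  rw [expansionCoeff_X_pow (by omega), expansionCoeff_X_pow (by omega), ← mul_sub,
    show n * p.2 + (e + 1 - j) = n * p.2 + (e - j) + 1 by omega,
    show n * p.2 + (e + 1 - (j + 1)) = n * p.2 + (e - j) by omega, Nat.choose_succ_succ]
  push_cast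
  ring

/-! ### Reflection symmetry of `U_n t^j` -/

theorem coeff_expand_mul_mk (n : ℕ) (hn : 0 < n) (q : ℤ[X]) (g : ℕ → ℤ) (i : ℕ) :
    PowerSeries.coeff (n * i) ((expand ℤ n q : PowerSeries ℤ) * PowerSeries.mk g) =
      PowerSeries.coeff i ((q : PowerSeries ℤ) * PowerSeries.mk fun m => g (n * m)) := by
  induction q using Polynomial.induction_on' with
  | add p q hp hq => simp only [map_add, Polynomial.coe_add, add_mul, hp, hq]
  | monomial k a =>
    rw [expand_monomial, ← C_mul_X_pow_eq_monomial, ← C_mul_X_pow_eq_monomial]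
    push_cast
    rw [mul_assoc, mul_assoc, PowerSeries.coeff_C_mul, PowerSeries.coeff_C_mul,
      PowerSeries.coeff_X_pow_mul', PowerSeries.coeff_X_pow_mul', mul_comm k n]
    simp only [mul_le_mul_iff_right₀ hn, PowerSeries.coeff_mk, Nat.mul_sub]

/-- Taking every `n`-th coefficient commutes with multiplication by a series in `t^n`; apply this to
`(1 - t^n)^(d+1)` and divide by `(1 - t)^(d+1)`. -/
theorem coeff_heckeU_eq_coeff_mul_geom_sum {d i n : ℕ} (hi : i ≤ d) (hn : 0 < n) (h : ℤ[X]) :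
    (heckeU d n h).coeff i = (h * (∑ k ∈ Finset.range n, X ^ k) ^ (d + 1)).coeff (n * i) := by
  rw [coeff_heckeU_eq_coeff_mul hi]
  have h1 := coeff_expand_mul_mk n hn ((1 - X) ^ (d + 1)) (expansionCoeff d h) i
  rw [← Polynomial.coeff_coe]
  push_cast at h1 ⊢
  rw [← h1, coe_eq_one_sub_X_pow_mul_mk d h]
  have h2 : ((∑ k ∈ Finset.range n, X ^ k : ℤ[X]) : PowerSeries ℤ) * (1 - PowerSeries.X) =
      ((expand ℤ n (1 - X) : ℤ[X]) : PowerSeries ℤ) := by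
    have := geom_sum_mul_neg (X : ℤ[X]) n
    have h3 := congrArg (fun q : ℤ[X] => (q : PowerSeries ℤ)) this
    simpa using h3
  rw [map_pow, Polynomial.coe_pow, ← h2, mul_pow]
  congr 1
  ring

theorem reflect_geom_sum_pow (n e : ℕ) :
    reflect (e * (n - 1)) ((∑ k ∈ Finset.range n, X ^ k : ℤ[X]) ^ e) =
      (∑ k ∈ Finset.range n, X ^ k) ^ e := by
  have hc : ∀ i, (∑ k ∈ Finset.range n, X ^ k : ℤ[X]).coeff i = if i < n then 1 else 0 := by
    intro i
    simp [finsetSum_coeff, coeff_X_pow]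
  have hdeg : (∑ k ∈ Finset.range n, X ^ k : ℤ[X]).natDegree ≤ n - 1 := by
    rw [natDegree_le_iff_coeff_eq_zero]
    intro N hN
    rw [hc, if_neg (by omega)]
  have h1 : reflect (n - 1) (∑ k ∈ Finset.range n, X ^ k : ℤ[X]) =
      ∑ k ∈ Finset.range n, X ^ k := by
    ext i
    rw [coeff_reflect, hc, hc]
    rcases le_or_gt i (n - 1) with h | h
    · rw [revAt_le h]
      rcases Nat.eq_zero_or_pos n with rfl | hn
      · simp
      · rw [if_pos (by omega), if_pos (by omega)]
    · rw [revAt_eq_self_of_lt h]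
  induction e with
  | zero => simp
  | succ e ih =>
    rw [pow_succ, Nat.succ_mul, reflect_mul _ _ (natDegree_pow_le_of_le e hdeg) hdeg, ih, h1]

theorem coeff_heckeU_X_pow_symm {d n i i' j j' : ℕ} (hn : 0 < n) (hi : i + i' = d + 1)
    (hi0 : 0 < i) (hi0' : 0 < i') (hj : j + j' = d + 1) :
    (heckeU d n (X ^ j)).coeff i = (heckeU d n (X ^ j')).coeff i' := by
  rw [coeff_heckeU_eq_coeff_mul_geom_sum (by omega) hn,
    coeff_heckeU_eq_coeff_mul_geom_sum (by omega) hn, coeff_X_pow_mul', coeff_X_pow_mul']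
  have hr := reflect_geom_sum_pow n (d + 1)
  set P := (∑ k ∈ Finset.range n, X ^ k : ℤ[X]) ^ (d + 1) with hP
  -- The positions `n i - j` and `n i' - j'` are mirror images in a palindrome of degree `(d + 1)(n
  -- - 1)`; if one is negative, the other exceeds the degree.
  have hN : (d + 1) * (n - 1) + (j + j') = n * i + n * i' := by
    rw [hj, ← mul_add, hi, ← Nat.mul_succ, mul_comm]
    congr 1
    omega
  have hP0 : ∀ k, (d + 1) * (n - 1) < k → P.coeff k = 0 := by
    intro k hk
    have hle : (∑ k ∈ Finset.range n, X ^ k : ℤ[X]).natDegree ≤ n - 1 :=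
      natDegree_sum_le_of_forall_le _ _ fun k hk => by
        rw [natDegree_X_pow]
        have := Finset.mem_range.1 hk
        omega
    exact coeff_eq_zero_of_natDegree_lt ((natDegree_pow_le_of_le (d + 1) hle).trans_lt hk)
  split_ifs with h1 h2 h2
  · have h3 := coeff_reflect ((d + 1) * (n - 1)) P (n * i - j)
    rw [hr, revAt_le (by omega)] at h3
    rw [h3]
    congr 1
    omega
  · exact hP0 _ (by omega)
  · exact (hP0 _ (by omega)).symm
  · rfl

/-! ### Transfer of strict inequalities from `A_d`, uniformly in `h` -/

theorem sum_range_mul_pos {R : Type*} [Ring R] [LinearOrder R] [IsStrictOrderedRing R] {d : ℕ}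
    {c w : ℕ → R} (hc : ∀ j, 0 ≤ c j) (hc0 : 0 < c 0) (hw : ∀ j ≤ d, 0 < w j) :
    0 < ∑ j ∈ Finset.range (d + 1), c j * w j := by
  refine Finset.sum_pos' (fun j hj => mul_nonneg (hc j) (hw j ?_).le) ⟨0, by simp, ?_⟩
  · simpa [Nat.lt_succ_iff] using hj
  · exact mul_pos hc0 (hw 0 (Nat.zero_le d))

/-- Only finitely many `j` matter, so one threshold on `n` serves every `h`; the term `j = 0` keeps
the inequality strict. -/
theorem eventually_coeff_heckeU_lt {d i k : ℕ} (hd : 0 < d) (hi : i ≤ d) (hk : k ≤ d) {c : ℤ}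
    (hc : (eulerianPoly d).coeff i < c * (eulerianPoly d).coeff k) :
    ∀ᶠ n in Filter.atTop, ∀ h : ℤ[X], h.natDegree ≤ d → (∀ i, 0 ≤ h.coeff i) → h.coeff 0 = 1 →
      (heckeU d n h).coeff i < c * (heckeU d n h).coeff k := by
  have hj : ∀ᶠ n : ℕ in Filter.atTop, ∀ j ∈ Finset.range (d + 1),
      0 < c * (heckeU d n (X ^ j)).coeff k - (heckeU d n (X ^ j)).coeff i := by
    rw [Filter.eventually_all_finset]
    intro j hj
    have hj' : j ≤ d := by simpa [Nat.lt_succ_iff] using hj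
    have ht := ((tendsto_coeff_heckeU_X_pow hd hk hj').const_mul (c : ℝ)).sub
      (tendsto_coeff_heckeU_X_pow hd hi hj')
    have hpos : (0 : ℝ) < c * (((eulerianPoly d).coeff k : ℝ) / d.factorial) -
        ((eulerianPoly d).coeff i : ℝ) / d.factorial := by
      rw [← mul_div_assoc, ← sub_div]
      refine div_pos ?_ (by positivity)
      exact_mod_cast sub_pos.2 hc
    filter_upwards [ht.eventually_const_lt hpos, Filter.eventually_gt_atTop 0] with n hn hn0
    rw [← mul_div_assoc, ← sub_div, div_pos_iff_of_pos_right (by positivity)] at hn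
    exact_mod_cast hn
  filter_upwards [hj] with n hn h hh hnn h0
  rw [← sub_pos, coeff_heckeU_eq_sum hi n hh, coeff_heckeU_eq_sum hk n hh, Finset.mul_sum,
    ← Finset.sum_sub_distrib]
  have := sum_range_mul_pos (d := d) hnn (by omega : 0 < h.coeff 0)
    (fun j hj => hn j (by simp; omega))
  refine this.trans_eq (Finset.sum_congr rfl fun j _ => ?_)
  ring

theorem eventually_eval_heckeU_pos {d : ℕ} (hd : 0 < d) {x ε : ℝ}
    (hx : 0 < ε * ((eulerianPoly d).map (Int.castRingHom ℝ)).eval x) :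
    ∀ᶠ n in Filter.atTop, ∀ h : ℤ[X], h.natDegree ≤ d → (∀ i, 0 ≤ h.coeff i) → h.coeff 0 = 1 →
      0 < ε * ((heckeU d n h).map (Int.castRingHom ℝ)).eval x := by
  have hev : ∀ q : ℤ[X], q.natDegree ≤ d → (q.map (Int.castRingHom ℝ)).eval x =
      ∑ i ∈ Finset.range (d + 1), (q.coeff i : ℝ) * x ^ i := fun q hq => by
    rw [eval_eq_sum_range' (Nat.lt_succ_of_le (natDegree_map_le.trans hq))]
    simp
  have hj : ∀ᶠ n : ℕ in Filter.atTop, ∀ j ∈ Finset.range (d + 1),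
      0 < ε * ((heckeU d n (X ^ j)).map (Int.castRingHom ℝ)).eval x := by
    rw [Filter.eventually_all_finset]
    intro j hj
    have hj' : j ≤ d := by simpa [Nat.lt_succ_iff] using hj
    have ht : Filter.Tendsto (fun n : ℕ => ε * (∑ i ∈ Finset.range (d + 1),
        ((heckeU d n (X ^ j)).coeff i : ℝ) / (n : ℝ) ^ d * x ^ i)) Filter.atTop
        (nhds (ε * ∑ i ∈ Finset.range (d + 1),
          ((eulerianPoly d).coeff i : ℝ) / d.factorial * x ^ i)) :=
      (tendsto_finsetSum _ fun i hi => (tendsto_coeff_heckeU_X_pow hd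
        (by simpa [Nat.lt_succ_iff] using hi) hj').mul_const _).const_mul _
    have hsum : ∀ (a : ℕ → ℝ) (b : ℝ), ε * ∑ i ∈ Finset.range (d + 1), a i / b * x ^ i =
        (ε * ∑ i ∈ Finset.range (d + 1), a i * x ^ i) / b := by
      intro a b
      rw [mul_div_assoc, Finset.sum_div]
      congr 1
      exact Finset.sum_congr rfl fun i _ => by ring
    simp only [hsum, ← hev _ (natDegree_heckeU_le d _ _), ← hev _ (natDegree_eulerianPoly_le d)]
      at ht
    have hpos := div_pos hx (show (0 : ℝ) < d.factorial by positivity)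
    filter_upwards [ht.eventually_const_lt hpos, Filter.eventually_gt_atTop 0] with n hn hn0
    rwa [div_pos_iff_of_pos_right (by positivity)] at hn
  filter_upwards [hj] with n hn h hh hnn h0
  rw [eval_heckeU_eq_sum d n hh, Finset.mul_sum]
  have := sum_range_mul_pos (d := d) (c := fun j => (h.coeff j : ℝ))
    (fun j => by exact_mod_cast hnn j) (by simp [h0])
    (fun j hj => hn j (by simp; omega))
  refine this.trans_eq (Finset.sum_congr rfl fun j _ => ?_)
  ring

/-! ### Location and convergence of the roots -/

/-- One separator is prescribed so that it can be pushed towards a chosen root in the proof of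
convergence. -/
theorem exists_separators {d : ℕ} {ρ : Fin d → ℝ} (i : Fin d) {x : ℝ} (hx : x < ρ i)
    (hx' : ∀ k < i, ρ k < x) (hρ : StrictMono ρ) :
    ∃ a : Fin d → ℝ, a i = x ∧ ∀ j, a j < ρ j ∧ ∀ k < j, ρ k < a j := by
  have hex : ∀ j, ∃ y, (y < ρ j ∧ ∀ k < j, ρ k < y) ∧ (j = i → y = x) := by
    intro j
    by_cases hj : j = i
    · subst hj
      exact ⟨x, ⟨hx, hx'⟩, fun _ => rfl⟩
    · have h1 : ∀ᶠ y in nhdsWithin (ρ j) (Set.Iio (ρ j)), ∀ k ∈ Finset.Iio j, ρ k < y := by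
        rw [Filter.eventually_all_finset]
        intro k hk
        filter_upwards [Ioo_mem_nhdsLT (hρ (Finset.mem_Iio.1 hk))] with y hy using hy.1
      obtain ⟨y, hy1, hy2⟩ := (h1.and self_mem_nhdsWithin).exists
      exact ⟨y, ⟨hy2, fun k hk => hy1 k (Finset.mem_Iio.2 hk)⟩, fun h => absurd h hj⟩
  choose a ha hai using hex
  exact ⟨a, hai i rfl, ha⟩

theorem eventually_roots_heckeU_interlace {e : ℕ} {ρ a : Fin (e + 1) → ℝ}
    (hlast : ρ (Fin.last e) = 0)
    (hA : (eulerianPoly (e + 1)).map (Int.castRingHom ℝ) = ∏ k, (X - C (ρ k)))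
    (hρ : StrictMono ρ) (ha : ∀ j, a j < ρ j ∧ ∀ k < j, ρ k < a j) :
    ∀ᶠ n in Filter.atTop, ∀ h : ℤ[X], h.natDegree ≤ e + 1 → (∀ i, 0 ≤ h.coeff i) →
      h.coeff 0 = 1 → ∃ β : Fin (e + 1) → ℝ, StrictMono β ∧ (∀ i, β i < 0) ∧ (∀ i, a i < β i) ∧
        (∀ i : Fin e, β i.castSucc < a i.succ) ∧
        ((heckeU (e + 1) n h).map (Int.castRingHom ℝ)).roots = Finset.univ.val.map β := by
  -- The last test point is `0`. There `A_d` vanishes, but `U_n h(0) = h_0 = 1` exactly, which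
  -- forces the largest root to be negative.
  have hs : StrictMono (Fin.snoc a 0 : Fin (e + 1 + 1) → ℝ) := by
    rw [Fin.strictMono_iff_lt_succ]
    intro i
    refine Fin.lastCases ?_ (fun i => ?_) i
    · rw [Fin.succ_last, Fin.snoc_last, Fin.snoc_castSucc, ← hlast]
      exact (ha _).1
    · rw [Fin.succ_castSucc, Fin.snoc_castSucc, Fin.snoc_castSucc]
      exact (ha _).1.trans ((ha _).2 _ Fin.castSucc_lt_succ)
  have hev : ∀ᶠ n in Filter.atTop, ∀ i : Fin (e + 1), ∀ h : ℤ[X], h.natDegree ≤ e + 1 →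
      (∀ i, 0 ≤ h.coeff i) → h.coeff 0 = 1 → 0 < (-1) ^ (e + 1 - (i : ℕ)) *
        ((heckeU (e + 1) n h).map (Int.castRingHom ℝ)).eval (a i) := by
    rw [Filter.eventually_all]
    intro i
    refine eventually_eval_heckeU_pos (Nat.succ_pos e) ?_
    rw [hA]
    exact sign_mul_eval_prod_X_sub_C_pos i (ha i).2
      fun k hk => (ha i).1.trans_le (hρ.monotone hk)
  filter_upwards [hev] with n hn h hh hnn h0
  obtain ⟨β, hβ, hβs, hroots⟩ := exists_roots_of_alternating
    (natDegree_map_le.trans (natDegree_heckeU_le (e + 1) n h)) hs (by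
      intro i
      refine Fin.lastCases ?_ (fun i => ?_) i
      · rw [Fin.snoc_last, Fin.val_last, Nat.sub_self, pow_zero, one_mul,
          ← coeff_zero_eq_eval_zero, coeff_map, coeff_zero_heckeU _ _ hh, h0]
        simp
      · rw [Fin.snoc_castSucc, Fin.val_castSucc]
        exact hn i h hh hnn h0)
  refine ⟨β, hβ, fun i => ?_, fun i => ?_, fun i => ?_, hroots⟩
  · refine (hβ.monotone (Fin.le_last i)).trans_lt ?_
    have := (hβs (Fin.last e)).2
    rwa [Fin.succ_last, Fin.snoc_last] at this
  · have := (hβs i).1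
    rwa [Fin.snoc_castSucc] at this
  · have := (hβs i.castSucc).2
    rwa [Fin.succ_castSucc, Fin.snoc_castSucc] at this

theorem tendsto_roots_heckeU {e : ℕ} {ρ : Fin (e + 1) → ℝ}
    (hlast : ρ (Fin.last e) = 0)
    (hA : (eulerianPoly (e + 1)).map (Int.castRingHom ℝ) = ∏ k, (X - C (ρ k)))
    (hρ : StrictMono ρ) {h : ℤ[X]} (hh : h.natDegree ≤ e + 1) (hnn : ∀ i, 0 ≤ h.coeff i)
    (h0 : h.coeff 0 = 1) {β : ℕ → Fin (e + 1) → ℝ}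
    (hβ : ∀ᶠ n in Filter.atTop, StrictMono (β n) ∧
      ((heckeU (e + 1) n h).map (Int.castRingHom ℝ)).roots = Finset.univ.val.map (β n))
    (i : Fin (e + 1)) : Filter.Tendsto (fun n => β n i) Filter.atTop (nhds (ρ i)) := by
  have key : ∀ a : Fin (e + 1) → ℝ, (∀ j, a j < ρ j ∧ ∀ k < j, ρ k < a j) →
      ∀ᶠ n in Filter.atTop, (∀ i, β n i < 0) ∧ (∀ i, a i < β n i) ∧
        ∀ i : Fin e, β n i.castSucc < a i.succ := by
    intro a ha
    filter_upwards [hβ, eventually_roots_heckeU_interlace hlast hA hρ ha] with n hn hn'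
    obtain ⟨γ, hγ, h1, h2, h3, h4⟩ := hn' h hh hnn h0
    rw [strictMono_eq_of_map_univ_eq hn.1 hγ (hn.2.symm.trans h4)]
    exact ⟨h1, h2, h3⟩
  have hlow : ∀ i, ∀ c < ρ i, ∃ x, c < x ∧ x < ρ i ∧ ∀ k < i, ρ k < x := by
    intro i c hc
    have h1 : ∀ᶠ y in nhdsWithin (ρ i) (Set.Iio (ρ i)), ∀ k ∈ Finset.Iio i, ρ k < y := by
      rw [Filter.eventually_all_finset]
      intro k hk
      filter_upwards [Ioo_mem_nhdsLT (hρ (Finset.mem_Iio.1 hk))] with y hy using hy.1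
    obtain ⟨y, hy1, hy2⟩ := (h1.and (Ioo_mem_nhdsLT hc)).exists
    exact ⟨y, hy2.1, hy2.2, fun k hk => hy1 k (Finset.mem_Iio.2 hk)⟩
  rw [tendsto_order]
  constructor
  · intro c hc
    obtain ⟨x, hx1, hx2, hx3⟩ := hlow i c hc
    obtain ⟨a, hai, ha⟩ := exists_separators i hx2 hx3 hρ
    filter_upwards [key a ha] with n hn
    exact hx1.trans (hai ▸ hn.2.1 i)
  · intro c hc
    -- An upper bound for the `i`-th root comes from a separator just above `ρ i`; the last root is
    -- bounded by `0` instead.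
    induction i using Fin.lastCases with
    | last =>
      obtain ⟨x, -, hx2, hx3⟩ := hlow (Fin.last e) (ρ (Fin.last e) - 1) (by linarith)
      obtain ⟨a, -, ha⟩ := exists_separators _ hx2 hx3 hρ
      filter_upwards [key a ha] with n hn
      exact (hn.1 _).trans (hlast ▸ hc)
    | cast i =>
      obtain ⟨x, hx1, hx2⟩ := exists_between (lt_min hc (hρ (Fin.castSucc_lt_succ (i := i))))
      obtain ⟨a, hai, ha⟩ := exists_separators i.succ (hx2.trans_le (min_le_right _ _))
        (fun k hk => (hρ.monotone (Fin.le_castSucc_iff.2 hk)).trans_lt hx1) hρ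
      filter_upwards [key a ha] with n hn
      have := hn.2.2 i
      rw [hai] at this
      exact this.trans (hx2.trans_le (min_le_left _ _))

/-! ### The inequality between mirrored coefficients -/

/-- Summation by parts for the pairing of a sequence with an antisymmetric decreasing one. -/
theorem sum_mul_pos_of_antisymm {e : ℕ} {c w : ℕ → ℤ} (hc0 : 0 < c 0)
    (hc : ∀ i, i + 1 ≤ (e + 1) / 2 →
      ∑ j ∈ Finset.range (i + 1), c (e + 1 - j) ≤ ∑ j ∈ Finset.range (i + 2), c j)
    (hanti : ∀ j k, 0 < j → 0 < k → j + k = e + 2 → w j + w k = 0)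
    (hdec : ∀ j ≤ e, w (j + 1) < w j) :
    0 < ∑ j ∈ Finset.range (e + 2), c j * w j := by
  set H : ℕ → ℤ := fun k => ∑ j ∈ Finset.range k, c j with hH
  have habel : ∀ m, ∑ j ∈ Finset.range (m + 1), c j * w j =
      H (m + 1) * w m + ∑ j ∈ Finset.range m, H (j + 1) * (w j - w (j + 1)) := by
    intro m
    induction m with
    | zero => simp [hH]
    | succ m ih =>
      rw [Finset.sum_range_succ, ih, Finset.sum_range_succ _ m,
        show H (m + 1 + 1) = H (m + 1) + c (m + 1) from Finset.sum_range_succ _ _]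
      ring
  have htel : ∑ k ∈ Finset.range e, (w (k + 1) - w (k + 1 + 1)) = -2 * w (e + 1) := by
    rw [Finset.sum_range_sub' (fun k => w (k + 1))]
    have := hanti 1 (e + 1) one_pos (by omega) (by omega)
    simp only [zero_add]
    linarith
  -- Antisymmetry of `w` makes its consecutive differences invariant under `k ↦ e - 1 - k`.
  have hrefl : ∑ k ∈ Finset.range e, H (k + 2) * (w (k + 1) - w (k + 1 + 1)) =
      ∑ k ∈ Finset.range e, H (e + 1 - k) * (w (k + 1) - w (k + 1 + 1)) := by
    rw [← Finset.sum_range_reflect]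
    refine Finset.sum_congr rfl fun k hk => ?_
    have hk' := Finset.mem_range.1 hk
    have h1 := hanti (e - 1 - k + 1) (k + 1 + 1) (by omega) (by omega) (by omega)
    have h2 := hanti (e - 1 - k + 1 + 1) (k + 1) (by omega) (by omega) (by omega)
    rw [show e - 1 - k + 1 + 1 = e + 1 - k by omega] at h2 ⊢
    congr 1
    linarith
  have hcompl : ∀ k ≤ e, ∑ j ∈ Finset.range (k + 1), c (e + 1 - j) = H (e + 2) - H (e + 1 - k) := by
    intro k hk
    rw [eq_sub_iff_add_eq]
    induction k with
    | zero =>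
      simp only [zero_add, Finset.sum_range_one, Nat.sub_zero]
      rw [show H (e + 2) = H (e + 1) + c (e + 1) from Finset.sum_range_succ _ _, add_comm]
    | succ k ih =>
      rw [← ih (by omega), Finset.sum_range_succ]
      have : H (e + 1 - k) = H (e + 1 - (k + 1)) + c (e + 1 - (k + 1)) := by
        rw [show e + 1 - k = e + 1 - (k + 1) + 1 by omega]
        exact Finset.sum_range_succ _ _
      rw [this]
      ring
  -- The hypothesis covers half of the range; the expression is invariant under `k ↦ e - 1 - k`.
  have hineq : ∀ k < e, 0 ≤ H (k + 2) + H (e + 1 - k) - H (e + 2) := by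
    intro k hk
    rcases le_or_gt (k + 1) ((e + 1) / 2) with h | h
    · have := hc k h
      rw [hcompl k hk.le] at this
      simp only [hH] at this ⊢
      linarith
    · have := hc (e - 1 - k) (by omega)
      rw [hcompl _ (by omega), show e + 1 - (e - 1 - k) = k + 2 by omega,
        show e - 1 - k + 2 = e + 1 - k by omega] at this
      simp only [hH] at this ⊢
      linarith
  -- Average the Abel sum with its reflection. The boundary term is absorbed by `htel`, and `w 0`,
  -- which has no mirror partner, stays apart.
  have h2 : 2 * ∑ j ∈ Finset.range (e + 2), c j * w j = 2 * (c 0 * (w 0 - w 1)) +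
      ∑ k ∈ Finset.range e, (H (k + 2) + H (e + 1 - k) - H (e + 2)) *
        (w (k + 1) - w (k + 1 + 1)) := by
    rw [habel, Finset.sum_range_succ' _ e]
    simp only [add_mul, sub_mul (H _ + H _), Finset.sum_add_distrib, Finset.sum_sub_distrib,
      ← Finset.mul_sum, htel, ← hrefl]
    have : H (0 + 1) = c 0 := by simp [hH]
    rw [this]
    ring
  have h3 : 0 ≤ ∑ k ∈ Finset.range e, (H (k + 2) + H (e + 1 - k) - H (e + 2)) *
      (w (k + 1) - w (k + 1 + 1)) :=
    Finset.sum_nonneg fun k hk => mul_nonneg (hineq k (Finset.mem_range.1 hk))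
      (sub_nonneg.2 (hdec _ (Finset.mem_range.1 hk)).le)
  have h4 := mul_pos hc0 (sub_pos.2 (hdec 0 (Nat.zero_le e)))
  simp only [zero_add] at h4
  linarith

/-- Let `w j` be the difference of the two coefficients for `U_n t^j`. It is antisymmetric by
reflection, and decreasing for large `n`: `(w j - w (j+1)) / n^e` tends to `2 (A(e, i+1) - A(e, i))
/ e!`, positive by unimodality. -/
theorem eventually_coeff_heckeU_reflect_lt {e i : ℕ} (hi : i + 1 ≤ (e + 1) / 2) :
    ∀ᶠ n in Filter.atTop, ∀ h : ℤ[X], h.natDegree ≤ e + 1 → h.coeff 0 = 1 →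
      (∀ i, i + 1 ≤ (e + 1) / 2 →
        ∑ j ∈ Finset.range (i + 1), h.coeff (e + 1 - j) ≤ ∑ j ∈ Finset.range (i + 2), h.coeff j) →
      (heckeU (e + 1) n h).coeff (e + 1 - i) < (heckeU (e + 1) n h).coeff (i + 1) := by
  have he : 0 < e := by omega
  have hj : ∀ᶠ n : ℕ in Filter.atTop, ∀ j ∈ Finset.range (e + 1),
      0 < ((heckeU (e + 1) n (X ^ j)).coeff (i + 1) -
          (heckeU (e + 1) n (X ^ (j + 1))).coeff (i + 1)) -
        ((heckeU (e + 1) n (X ^ j)).coeff (e - i + 1) -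
          (heckeU (e + 1) n (X ^ (j + 1))).coeff (e - i + 1)) := by
    rw [Filter.eventually_all_finset]
    intro j hj
    have hj' : j ≤ e := by simpa [Nat.lt_succ_iff] using hj
    have ht := (tendsto_coeff_heckeU_X_pow_sub he (show i + 1 ≤ e + 1 by omega) hj').sub
      (tendsto_coeff_heckeU_X_pow_sub he (show e - i + 1 ≤ e + 1 by omega) hj')
    have hcoeff : ∀ k, ((1 - X) * eulerianPoly e).coeff (k + 1) =
        (eulerianPoly e).coeff (k + 1) - (eulerianPoly e).coeff k := fun k => by
      rw [sub_mul, one_mul, coeff_sub, coeff_X_mul]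
    have hlt := eulerianPoly_coeff_lt_succ he (show 2 * i + 1 ≤ e by omega)
    have hpos : (0 : ℝ) < (((1 - X) * eulerianPoly e).coeff (i + 1) : ℝ) / e.factorial -
        (((1 - X) * eulerianPoly e).coeff (e - i + 1) : ℝ) / e.factorial := by
      rw [← sub_div]
      refine div_pos ?_ (by positivity)
      rw [← Int.cast_sub, Int.cast_pos, hcoeff, hcoeff,
        eulerianPoly_coeff_symm he (show e - i + 1 + i = e + 1 by omega),
        eulerianPoly_coeff_symm he (show e - i + (i + 1) = e + 1 by omega)]
      linarith
    filter_upwards [ht.eventually_const_lt hpos, Filter.eventually_gt_atTop 0] with n hn hn0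
    rw [← sub_div, div_pos_iff_of_pos_right (by positivity)] at hn
    exact_mod_cast hn
  filter_upwards [hj, Filter.eventually_gt_atTop 0] with n hn hn0 h hh h0 hc
  rw [← sub_pos, coeff_heckeU_eq_sum (by omega) n hh, coeff_heckeU_eq_sum (by omega) n hh,
    ← Finset.sum_sub_distrib]
  simp only [← mul_sub]
  refine sum_mul_pos_of_antisymm (by omega) hc (fun j k hj hk hjk => ?_) fun j hj => ?_
  · rw [coeff_heckeU_X_pow_symm hn0 (show i + 1 + (e + 1 - i) = e + 1 + 1 by omega) (by omega)
      (by omega) hjk, coeff_heckeU_X_pow_symm hn0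
      (show e + 1 - i + (i + 1) = e + 1 + 1 by omega) (by omega) (by omega) hjk]
    ring
  · have := hn j (by simp; omega)
    rw [show e + 1 - i = e - i + 1 by omega]
    linarith

/-! ### Assembly -/

theorem mainTheorem1 (d : ℕ) (hd : 0 < d) :
    ∃ ρ : Fin d → ℝ,
      StrictMono ρ ∧ ρ ⟨d - 1, Nat.sub_one_lt_of_lt hd⟩ = 0 ∧
      ((eulerianPoly d).map (Int.castRingHom ℝ)).roots = Finset.univ.val.map ρ ∧
      ∃ m_d n_d : ℕ, 0 < m_d ∧ 0 < n_d ∧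
        ∀ h : ℤ[X], h.natDegree ≤ d → (∀ i, 0 ≤ h.coeff i) → h.coeff 0 = 1 →
          (∃ β : ℕ → Fin d → ℝ,
            (∀ n, n_d ≤ n →
              StrictMono (β n) ∧ (∀ i, β n i < 0) ∧
              ((heckeU d n h).map (Int.castRingHom ℝ)).roots = Finset.univ.val.map (β n)) ∧
            ∀ i, Filter.Tendsto (fun n => β n i) Filter.atTop (nhds (ρ i))) ∧
          (∀ n, n_d ≤ n →
            (∀ i, i ≤ d → 0 < (heckeU d n h).coeff i) ∧
            (∀ i, 1 ≤ i → i + 1 ≤ d →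
              (heckeU d n h).coeff (i - 1) * (heckeU d n h).coeff (i + 1) <
                (heckeU d n h).coeff i ^ 2) ∧
            (∀ i, i ≤ d → (heckeU d n h).coeff i < m_d * (heckeU d n h).coeff d)) ∧
          ((∀ i, i + 1 ≤ d / 2 →
              ∑ j ∈ Finset.range (i + 1), h.coeff (d - j) ≤
                ∑ j ∈ Finset.range (i + 2), h.coeff j) →
            ∀ n, n_d ≤ n →
              h.coeff 0 = (heckeU d n h).coeff 0 ∧
              (∀ i, i < d - i →
                (heckeU d n h).coeff i < (heckeU d n h).coeff (d - i)) ∧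
              (∀ i, i + 1 ≤ d / 2 →
                (heckeU d n h).coeff (d - i) < (heckeU d n h).coeff (i + 1)) ∧
              (heckeU d n h).coeff ((d + 1) / 2) < m_d * (heckeU d n h).coeff d) := by
  obtain ⟨e, rfl⟩ : ∃ e, d = e + 1 := ⟨d - 1, by omega⟩
  obtain ⟨ρ, hρ, hlast, hA⟩ := eulerianPoly_eq_prod e
  refine ⟨ρ, hρ, hlast, ?_, ?_⟩
  · have := roots_multiset_prod_X_sub_C (Finset.univ.val.map ρ)
    rw [Multiset.map_map] at this
    rw [hA]
    exact this
  obtain ⟨a, -, ha⟩ := exists_separators (ρ := ρ) 0 (sub_one_lt (ρ 0))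
    (fun k hk => absurd hk (Fin.not_lt_zero k)) hρ
  -- Since `A_d` is monic, any number exceeding all its coefficients can serve as `m_d`.
  set M : ℕ := ∑ i ∈ Finset.range (e + 2), ((eulerianPoly (e + 1)).coeff i).natAbs + 1 with hM
  have hAM : ∀ i ≤ e + 1, (eulerianPoly (e + 1)).coeff i <
      (M : ℤ) * (eulerianPoly (e + 1)).coeff (e + 1) := by
    intro i hi
    rw [eulerianPoly_coeff_self hd, mul_one]
    have h1 := Finset.single_le_sum (f := fun i => ((eulerianPoly (e + 1)).coeff i).natAbs)
      (fun _ _ => Nat.zero_le _) (Finset.mem_range.2 (show i < e + 2 by omega))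
    omega
  have hev1 := eventually_roots_heckeU_interlace hlast hA hρ ha
  have hev2 := (Filter.eventually_all_finset (Finset.range (e + 2))).2 fun i hi =>
    eventually_coeff_heckeU_lt hd (by simpa [Nat.lt_succ_iff] using hi) le_rfl
      (hAM i (by simpa [Nat.lt_succ_iff] using hi))
  have hev3 := (Filter.eventually_all_finset
    ((Finset.range (e + 2)).filter fun i => i < e + 1 - i)).2 fun i hi =>
      eventually_coeff_heckeU_lt hd (i := i) (k := e + 1 - i) (c := 1) (by simp at hi; omega)
        (by omega) (by
          rw [one_mul]
          exact eulerianPoly_coeff_lt_of_lt hd (Finset.mem_filter.1 hi).2)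
  have hev4 := (Filter.eventually_all_finset
    ((Finset.range (e + 2)).filter fun i => i + 1 ≤ (e + 1) / 2)).2 fun i hi =>
      eventually_coeff_heckeU_reflect_lt (e := e) (i := i) (Finset.mem_filter.1 hi).2
  obtain ⟨N, hN⟩ := Filter.eventually_atTop.1 (hev1.and (hev2.and (hev3.and hev4)))
  refine ⟨M, N + 1, Nat.succ_pos _, Nat.succ_pos _, fun h hh hnn h0 => ⟨?_, ?_, ?_⟩⟩
  · have hβ : ∀ n, ∃ β : Fin (e + 1) → ℝ, N + 1 ≤ n → StrictMono β ∧ (∀ i, β i < 0) ∧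
        ((heckeU (e + 1) n h).map (Int.castRingHom ℝ)).roots = Finset.univ.val.map β := by
      intro n
      by_cases hn : N + 1 ≤ n
      · obtain ⟨β, h1, h2, -, -, h3⟩ := (hN n (by omega)).1 h hh hnn h0
        exact ⟨β, fun _ => ⟨h1, h2, h3⟩⟩
      -- A default below the threshold, without effect on the limit.
      · exact ⟨0, fun h => absurd h hn⟩
    choose β hβ using hβ
    refine ⟨β, hβ, tendsto_roots_heckeU hlast hA hρ hh hnn h0 ?_⟩
    filter_upwards [Filter.eventually_ge_atTop (N + 1)] with n hn
    exact ⟨(hβ n hn).1, (hβ n hn).2.2⟩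
  · intro n hn
    obtain ⟨h1, h2, h3, -⟩ := hN n (by omega)
    obtain ⟨β, -, hβ, -, -, hroots⟩ := h1 h hh hnn h0
    -- The case `i = 0` of `h3` reads `1 = h_0(n) < h_d(n)`.
    have hlead : (0 : ℝ) < ((heckeU (e + 1) n h).map (Int.castRingHom ℝ)).coeff (e + 1) := by
      have := h3 0 (by simp) h hh hnn h0
      rw [coeff_zero_heckeU _ _ hh, h0, one_mul, Nat.sub_zero] at this
      rw [coeff_map, eq_intCast, Int.cast_pos]
      omega
    obtain ⟨hpos, hlc⟩ := coeff_pos_and_strict_log_concave hlead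
      (natDegree_map_le.trans (natDegree_heckeU_le _ _ _)) hβ hroots
    simp only [coeff_map, eq_intCast] at hpos hlc
    refine ⟨fun i hi => by exact_mod_cast hpos i hi, fun i hi1 hi2 => ?_, fun i hi => ?_⟩
    · have := hlc (i - 1) (by omega)
      rw [show i - 1 + 2 = i + 1 by omega, show i - 1 + 1 = i by omega] at this
      exact_mod_cast this
    · exact h2 i (by simp; omega) h hh hnn h0
  · intro hc n hn
    obtain ⟨-, h2, h3, h4⟩ := hN n (by omega)
    refine ⟨(coeff_zero_heckeU _ _ hh).symm, fun i hi => ?_, fun i hi => ?_, ?_⟩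
    · simpa using h3 i (by simp; omega) h hh hnn h0
    · exact h4 i (by simp; omega) h hh h0 hc
    · exact h2 _ (by simp; omega) h hh hnn h0
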